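/- Let $\alpha,\beta>0$ and $k,m\in[0,1)$. Let $K(r)=\int_0^{\pi/2}(1-r\sin^2 s)^{-1/2}\,ds$, and let $\operatorname{sn}(\cdot,r)$ and $\operatorname{nd}(\cdot,r)=1/\operatorname{dn}(\cdot,r)$ be the Jacobi elliptic functions in the same parameter convention, that is, $\operatorname{sn}(u,r)=\sin\varphi$ and $\operatorname{dn}(u,r)=\sqrt{1-r\sin^2\varphi}$ where $u=\int_0^\varphi(1-r\sin^2 s)^{-1/2}\,ds$. For $i\in\{5,7\}$ and $x_1,x_2\in\mathbb R$ put $$B_i(t,x)=2\,\partial_x\arctan\Big(\frac{\beta}{\alpha}\,\frac{\operatorname{sn}(\alpha y_1,k)}{\operatorname{nd}(\beta y_2,m)}\Big),\qquad y_1=x+\delta_{i,m}t+x_1,\quad y_2=x+\gamma_{i,m}t+x_2,$$ with velocities $$\delta_{5,m}=-\alpha^4(k^2-26k+1)+10\alpha^2\beta^2(1+k)(2-m)-5\beta^4(m^2-16m+16),$$ $$\gamma_{5,m}=-\beta^4(m^2+24m-24)+10\alpha^2\beta^2(1+k)(2-m)-5\alpha^4(k^2+14k+1),$$ $$\begin{aligned}\delta_{7,m}={}&\alpha^6(k^3+135k^2+135k+1)+21\alpha^4\beta^2\big(-2+k^2(m-2)+m+2k(7m-6)\big)\\&+7\alpha^2\beta^4(1+k)(5m^2-24m+24)+7\beta^6(m^3-2m^2+48m-48),\end{aligned}$$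 $$\begin{aligned}\gamma_{7,m}={}&-\beta^6(-m^3-254m^2-2256m+2512)+7\alpha^2\beta^4(1+k)(3m^2+88m-88)\\&+7\alpha^4\beta^2\big(5(k^2+1)(m-2)+k(70m+292)\big)+7\alpha^6(k^3+135k^2+135k+1).\end{aligned}$$ Consider the 5th and 7th order mKdV equations $$u_t+\big(u_{4x}+10uu_x^2+10u^2u_{xx}+6u^5\big)_x=0,$$ $$u_t+\big(u_{6x}+14u^2u_{4x}+56uu_xu_{3x}+42uu_{xx}^2+70u_x^2u_{xx}+70u^4u_{xx}+140u^3u_x^2+20u^7\big)_x=0.$$ Then for $i=5$ and for $i=7$: (a) $B_i$ is a smooth solution, on all of $\mathbb R_t\times\mathbb R_x$, of the $i$-th order mKdV equation for all $x_1,x_2\in\mathbb R$ if and only if $\dfrac{\beta^4}{\alpha^4}=\dfrac{k}{1-m}$. (b) For all $x_1,x_2\in\mathbb R$, the numbers $\frac4\alpha K(k)$ and $\frac2\beta K(m)$ are both the fundamental (least positive) spatial period of $B_i(t,\cdot)$ at every time $t$ if and only if $K(k)=\dfrac{\alpha}{2\beta}K(m)$. In particular, if $\beta^4/\alpha^4=k/(1-m)$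 and $K(k)=\frac{\alpha}{2\beta}K(m)$, then $B_i$ is a spatially periodic solution of the $i$-th order mKdV equation with period $L=\frac4\alpha K(k)=\frac2\beta K(m)$. -/

import Mathlib

open scoped ContDiff

noncomputable section

namespace PeriodicMKdV

/-- Incomplete elliptic integral of the first kind, in the parameter convention:
`F(φ, r) = ∫₀^φ (1 - r sin² s)^(-1/2) ds`. For `0 ≤ r < 1` the integrand is continuous and at
least `1`, so `F(·, r)` is an increasing bijection of `ℝ`. -/
def ellipticF (r φ : ℝ) : ℝ :=
  ∫ s in (0 : ℝ)..φ, 1 / Real.sqrt (1 - r * Real.sin s ^ 2)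

/-- Complete elliptic integral of the first kind,
`K(r) = ∫₀^{π/2} (1 - r sin² s)^(-1/2) ds`, for `0 ≤ r < 1`. -/
def ellipticK (r : ℝ) : ℝ :=
  ∫ s in (0 : ℝ)..(Real.pi / 2), 1 / Real.sqrt (1 - r * Real.sin s ^ 2)

/-- Jacobi amplitude `am(·, r)`: the inverse function of `F(·, r)`, for `0 ≤ r < 1`. -/
def jacobiAm (r u : ℝ) : ℝ := Function.invFun (ellipticF r) u

/-- Jacobi `sn(u, r) = sin am(u, r)`. -/
def jacobiSn (u r : ℝ) : ℝ := Real.sin (jacobiAm r u)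

/-- Jacobi `dn(u, r) = √(1 - r sn(u, r)²)`. -/
def jacobiDn (u r : ℝ) : ℝ := Real.sqrt (1 - r * jacobiSn u r ^ 2)

/-- Jacobi `nd(u, r) = 1 / dn(u, r)`. -/
def jacobiNd (u r : ℝ) : ℝ := 1 / jacobiDn u r

/-- The function
`B(t, x) = 2 ∂ₓ arctan ((β/α) sn(α y₁, k) / nd(β y₂, m))`,
with `y₁ = x + δ t + x₁` and `y₂ = x + γ t + x₂`. -/
def breather (α β k m δ γ x₁ x₂ t x : ℝ) : ℝ :=
  2 * deriv (fun z : ℝ => Real.arctan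
    (β / α * (jacobiSn (α * (z + δ * t + x₁)) k / jacobiNd (β * (z + γ * t + x₂)) m))) x

/-- `v_{4x} + 10 v v_x² + 10 v² v_{xx} + 6 v⁵`. -/
def flux5 (v : ℝ → ℝ) (x : ℝ) : ℝ :=
  iteratedDeriv 4 v x + 10 * v x * deriv v x ^ 2 + 10 * v x ^ 2 * iteratedDeriv 2 v x
    + 6 * v x ^ 5

/-- `v_{6x} + 14 v² v_{4x} + 56 v v_x v_{3x} + 42 v v_{xx}² + 70 v_x² v_{xx} + 70 v⁴ v_{xx}
+ 140 v³ v_x² + 20 v⁷`. -/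
def flux7 (v : ℝ → ℝ) (x : ℝ) : ℝ :=
  iteratedDeriv 6 v x + 14 * v x ^ 2 * iteratedDeriv 4 v x
    + 56 * v x * deriv v x * iteratedDeriv 3 v x + 42 * v x * iteratedDeriv 2 v x ^ 2
    + 70 * deriv v x ^ 2 * iteratedDeriv 2 v x + 70 * v x ^ 4 * iteratedDeriv 2 v x
    + 140 * v x ^ 3 * deriv v x ^ 2 + 20 * v x ^ 7

/-- `u = u(t, x)` is a smooth global solution of `u_t + (Φ(u))_x = 0`. -/
def IsSmoothSolution (Φ : (ℝ → ℝ) → ℝ → ℝ) (u : ℝ → ℝ → ℝ) : Prop :=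
  ContDiff ℝ ∞ (fun p : ℝ × ℝ => u p.1 p.2) ∧
    ∀ t x : ℝ, deriv (fun s : ℝ => u s x) t + deriv (Φ (u t)) x = 0

/-- The 5th order mKdV equation `u_t + (u_{4x} + f₅(u))_x = 0`. -/
def SolvesMKdV5 (u : ℝ → ℝ → ℝ) : Prop := IsSmoothSolution flux5 u

/-- The 7th order mKdV equation `u_t + (u_{6x} + f₇(u))_x = 0`. -/
def SolvesMKdV7 (u : ℝ → ℝ → ℝ) : Prop := IsSmoothSolution flux7 u

/-- `L` is the fundamental (least positive) period in `x` of `u(t, ·)`, for every time `t`. -/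
def HasSpatialPeriod (u : ℝ → ℝ → ℝ) (L : ℝ) : Prop :=
  ∀ t : ℝ, IsLeast {T : ℝ | 0 < T ∧ Function.Periodic (u t) T} L

/-- The velocity `δ_{5,m}`. -/
def delta5 (α β k m : ℝ) : ℝ :=
  -α ^ 4 * (k ^ 2 - 26 * k + 1) + 10 * α ^ 2 * β ^ 2 * (1 + k) * (2 - m)
    - 5 * β ^ 4 * (m ^ 2 - 16 * m + 16)

/-- The velocity `γ_{5,m}`. -/
def gamma5 (α β k m : ℝ) : ℝ :=
  -β ^ 4 * (m ^ 2 + 24 * m - 24) + 10 * α ^ 2 * β ^ 2 * (1 + k) * (2 - m)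
    - 5 * α ^ 4 * (k ^ 2 + 14 * k + 1)

/-- The velocity `δ_{7,m}`. -/
def delta7 (α β k m : ℝ) : ℝ :=
  α ^ 6 * (k ^ 3 + 135 * k ^ 2 + 135 * k + 1)
    + 21 * α ^ 4 * β ^ 2 * (-2 + k ^ 2 * (m - 2) + m + 2 * k * (7 * m - 6))
    + 7 * α ^ 2 * β ^ 4 * (1 + k) * (5 * m ^ 2 - 24 * m + 24)
    + 7 * β ^ 6 * (m ^ 3 - 2 * m ^ 2 + 48 * m - 48)

/-- The velocity `γ_{7,m}`. -/
def gamma7 (α β k m : ℝ) : ℝ :=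
  -β ^ 6 * (-m ^ 3 - 254 * m ^ 2 - 2256 * m + 2512)
    + 7 * α ^ 2 * β ^ 4 * (1 + k) * (3 * m ^ 2 + 88 * m - 88)
    + 7 * α ^ 4 * β ^ 2 * (5 * (k ^ 2 + 1) * (m - 2) + k * (70 * m + 292))
    + 7 * α ^ 6 * (k ^ 3 + 135 * k ^ 2 + 135 * k + 1)

end PeriodicMKdV

end

/-!
Write `s(y) = (β/α) sn(α y, k)`, `d(y) = dn(β y, m)` and `Θ(y₁, y₂) = arctan (s(y₁) d(y₂))`, so that
the breather is `u = 2 (P + Q)` with `P = ∂₁Θ`, `Q = ∂₂Θ`. Both profiles are quartic oscillators: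
`s'² = a₀ + a₁ s² + a₂ s⁴` and `d'² = b₀ + b₁ d² - a₀ d⁴`, with `a₀ = β²`, `a₁ = -α² (1 + k)`,
`a₂ = k α⁴ / β²`, `b₀ = -β² (1 - m)`, `b₁ = β² (2 - m)`. The condition `β⁴/α⁴ = k/(1 - m)` is the
resonance `b₀ = -a₂`. Since `u_t = ∂ₓ (2 (δ P + γ Q))`, the equation with flux `Φ` says that
`Φ(u) + 2 (δ P + γ Q)` does not depend on `x`.

*Resonance implies the equations.* With resonance, `P`, `Q` and three auxiliary functions built from
`Θ` and its derivatives satisfy a closed polynomial system with three polynomial constraints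
(`angleSystem_of_quarticOscillator`). In it `v = u'' + 2 u³` is linear in `P, Q`, and `v''` is a
polynomial in `u, u', v`; hence `flux5 u` and `flux7 u` are linear in `P, Q`
(`AngleSystem.flux_eq`), and the coefficients are `-2 δ`, `-2 γ` for the stated velocities
(`solves_of_resonance`).

*The equations imply resonance.* Take both phases zero. The second Taylor coefficient at the origin
of `Φ(u) + 2 (δ P + γ Q)` at time `0` must vanish; without assuming resonance it is computed from
the recursions for the coefficients of `s` and `d` (`taylorCoeff_twoPhase`), and it factors as
`k α⁴ - β⁴ (1 - m)` times a factor of constant sign (`resonance_of_isSmoothSolution_twoPhase`).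

*Periods.* A least period is unique, so the two numbers agree if both are fundamental periods.
Conversely, if they agree then their common value is a period of `s` and of `d`; any period of `u`
is one of the bounded angle, hence of `s(y₁) d(y₂)`, whose zeros are half of that value apart and
which changes sign under a shift by that half (`hasSpatialPeriod_breather`).
-/

open scoped ContDiff

namespace PeriodicMKdV

/-! ### Elliptic integrals and Jacobi functions -/

section Elliptic

variable {r : ℝ}

lemma one_sub_mul_sin_sq_pos (hr : r ∈ Set.Ico (0 : ℝ) 1) (s : ℝ) :
    0 < 1 - r * Real.sin s ^ 2 := by
  nlinarith [Real.sin_sq_le_one s, sq_nonneg (Real.sin s), hr.1, hr.2]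

lemma continuous_ellipticF_integrand (hr : r ∈ Set.Ico (0 : ℝ) 1) :
    Continuous fun s : ℝ => 1 / Real.sqrt (1 - r * Real.sin s ^ 2) :=
  Continuous.div (by fun_prop) (by fun_prop)
    fun s => (Real.sqrt_pos.2 (one_sub_mul_sin_sq_pos hr s)).ne'

lemma hasDerivAt_ellipticF (hr : r ∈ Set.Ico (0 : ℝ) 1) (φ : ℝ) :
    HasDerivAt (ellipticF r) (1 / Real.sqrt (1 - r * Real.sin φ ^ 2)) φ :=
  intervalIntegral.integral_hasDerivAt_right
    ((continuous_ellipticF_integrand hr).intervalIntegrable _ _)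
    ((continuous_ellipticF_integrand hr).stronglyMeasurableAtFilter _ _)
    (continuous_ellipticF_integrand hr).continuousAt

lemma one_le_ellipticF_integrand (hr : r ∈ Set.Ico (0 : ℝ) 1) (s : ℝ) :
    1 ≤ 1 / Real.sqrt (1 - r * Real.sin s ^ 2) := by
  rw [le_div_iff₀ (Real.sqrt_pos.2 (one_sub_mul_sin_sq_pos hr s)), one_mul]
  refine Real.sqrt_le_one.2 ?_
  nlinarith [sq_nonneg (Real.sin s), hr.1]

lemma strictMono_ellipticF (hr : r ∈ Set.Ico (0 : ℝ) 1) : StrictMono (ellipticF r) :=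
  strictMono_of_deriv_pos fun φ => by
    rw [(hasDerivAt_ellipticF hr φ).deriv]
    linarith [one_le_ellipticF_integrand hr φ]

lemma ellipticF_zero : ellipticF r 0 = 0 := by simp [ellipticF]

lemma ellipticF_neg (φ : ℝ) : ellipticF r (-φ) = -ellipticF r φ := by
  have h := intervalIntegral.integral_comp_neg (a := 0) (b := φ)
    (fun s : ℝ => 1 / Real.sqrt (1 - r * Real.sin s ^ 2))
  simp only [Real.sin_neg, neg_sq, neg_zero] at h
  rw [ellipticF, ellipticF, h, intervalIntegral.integral_symm]

lemma surjective_ellipticF (hr : r ∈ Set.Ico (0 : ℝ) 1) :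
    Function.Surjective (ellipticF r) := by
  have hcont : Continuous (ellipticF r) :=
    continuous_iff_continuousAt.2 fun φ => (hasDerivAt_ellipticF hr φ).continuousAt
  have hmono : Monotone fun φ => ellipticF r φ - φ := by
    refine monotone_of_hasDerivAt_nonneg
      (fun φ => (hasDerivAt_ellipticF hr φ).sub (hasDerivAt_id φ)) fun φ => ?_
    have := one_le_ellipticF_integrand hr φ
    simp only [Pi.zero_apply]
    linarith
  refine hcont.surjective ?_ ?_
  · refine Filter.tendsto_atTop_mono' _ ?_ Filter.tendsto_id
    filter_upwards [Filter.eventually_ge_atTop 0] with φ hφ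
    have := hmono hφ
    simp only [ellipticF_zero] at this
    simp only [id]
    linarith
  · refine Filter.tendsto_atBot_mono' _ ?_ Filter.tendsto_id
    filter_upwards [Filter.eventually_le_atBot 0] with φ hφ
    have := hmono hφ
    simp only [ellipticF_zero] at this
    simp only [id]
    linarith

lemma ellipticF_jacobiAm (hr : r ∈ Set.Ico (0 : ℝ) 1) (u : ℝ) :
    ellipticF r (jacobiAm r u) = u :=
  Function.rightInverse_invFun (surjective_ellipticF hr) u

lemma jacobiAm_ellipticF (hr : r ∈ Set.Ico (0 : ℝ) 1) (φ : ℝ) :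
    jacobiAm r (ellipticF r φ) = φ :=
  Function.leftInverse_invFun (strictMono_ellipticF hr).injective φ

lemma continuous_jacobiAm (hr : r ∈ Set.Ico (0 : ℝ) 1) : Continuous (jacobiAm r) := by
  have h : jacobiAm r = ((strictMono_ellipticF hr).orderIsoOfSurjective _
      (surjective_ellipticF hr)).symm := by
    funext u
    rw [eq_comm, OrderIso.symm_apply_eq]
    exact (ellipticF_jacobiAm hr u).symm
  rw [h]
  exact OrderIso.continuous _

lemma hasDerivAt_jacobiAm (hr : r ∈ Set.Ico (0 : ℝ) 1) (u : ℝ) :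
    HasDerivAt (jacobiAm r) (Real.sqrt (1 - r * Real.sin (jacobiAm r u) ^ 2)) u := by
  have hpos := Real.sqrt_pos.2 (one_sub_mul_sin_sq_pos hr (jacobiAm r u))
  have h := HasDerivAt.of_local_left_inverse (continuous_jacobiAm hr).continuousAt
    (hasDerivAt_ellipticF hr (jacobiAm r u)) (by positivity)
    (Filter.Eventually.of_forall (ellipticF_jacobiAm hr))
  simpa using h

lemma contDiff_jacobiAm (hr : r ∈ Set.Ico (0 : ℝ) 1) : ContDiff ℝ ∞ (jacobiAm r) := by
  rw [contDiff_infty]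
  intro n
  induction n with
  | zero => exact contDiff_zero.2 (continuous_jacobiAm hr)
  | succ n ih =>
    rw [Nat.cast_succ]
    refine contDiff_succ_iff_deriv.2
      ⟨fun u => (hasDerivAt_jacobiAm hr u).differentiableAt, by simp, ?_⟩
    rw [funext fun u => (hasDerivAt_jacobiAm hr u).deriv]
    exact ContDiff.sqrt (by fun_prop) fun u => (one_sub_mul_sin_sq_pos hr _).ne'

lemma ellipticF_pi_div_two : ellipticF r (Real.pi / 2) = ellipticK r := rfl

lemma ellipticF_add_pi (hr : r ∈ Set.Ico (0 : ℝ) 1) (φ : ℝ) :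
    ellipticF r (φ + Real.pi) = ellipticF r φ + 2 * ellipticK r := by
  set g : ℝ → ℝ := fun s => 1 / Real.sqrt (1 - r * Real.sin s ^ 2) with hg
  have hint : ∀ a b, IntervalIntegrable g MeasureTheory.volume a b :=
    fun a b => (continuous_ellipticF_integrand hr).intervalIntegrable a b
  have hper : Function.Periodic g Real.pi := fun s => by simp [hg]
  have h1 : ∫ s in φ..(φ + Real.pi), g s = ∫ s in (0 : ℝ)..Real.pi, g s := by
    simpa using hper.intervalIntegral_add_eq φ 0
  have h2 : ∫ s in (Real.pi / 2)..Real.pi, g s = ∫ s in (0 : ℝ)..(Real.pi / 2), g s := by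
    have h := intervalIntegral.integral_comp_sub_left (a := 0) (b := Real.pi / 2) g Real.pi
    simp only [hg, Real.sin_pi_sub] at h
    rw [hg, h, sub_zero, show Real.pi - Real.pi / 2 = Real.pi / 2 by ring]
  have h3 : ellipticF r (φ + Real.pi) = ellipticF r φ + ∫ s in φ..(φ + Real.pi), g s :=
    (intervalIntegral.integral_add_adjacent_intervals (hint _ _) (hint _ _)).symm
  have h4 : ∫ s in (0 : ℝ)..Real.pi, g s
      = (∫ s in (0 : ℝ)..(Real.pi / 2), g s) + ∫ s in (Real.pi / 2)..Real.pi, g s :=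
    (intervalIntegral.integral_add_adjacent_intervals (hint _ _) (hint _ _)).symm
  rw [h3, h1, h4, h2, ellipticK]
  ring

lemma ellipticK_pos (hr : r ∈ Set.Ico (0 : ℝ) 1) : 0 < ellipticK r := by
  rw [← ellipticF_pi_div_two, ← ellipticF_zero (r := r)]
  exact strictMono_ellipticF hr (by positivity)

lemma jacobiAm_add_two_mul_ellipticK (hr : r ∈ Set.Ico (0 : ℝ) 1) (u : ℝ) :
    jacobiAm r (u + 2 * ellipticK r) = jacobiAm r u + Real.pi := by
  rw [← jacobiAm_ellipticF hr (jacobiAm r u + Real.pi), ellipticF_add_pi hr,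
    ellipticF_jacobiAm hr]

lemma jacobiAm_neg (hr : r ∈ Set.Ico (0 : ℝ) 1) (u : ℝ) :
    jacobiAm r (-u) = -jacobiAm r u := by
  rw [← jacobiAm_ellipticF hr (-jacobiAm r u), ellipticF_neg, ellipticF_jacobiAm hr]

lemma jacobiAm_zero (hr : r ∈ Set.Ico (0 : ℝ) 1) : jacobiAm r 0 = 0 := by
  simpa [ellipticF_zero] using jacobiAm_ellipticF hr 0

lemma jacobiSn_add_two_mul_ellipticK (hr : r ∈ Set.Ico (0 : ℝ) 1) (u : ℝ) :
    jacobiSn (u + 2 * ellipticK r) r = -jacobiSn u r := by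
  rw [jacobiSn, jacobiAm_add_two_mul_ellipticK hr, Real.sin_add_pi, jacobiSn]

lemma jacobiDn_add_two_mul_ellipticK (hr : r ∈ Set.Ico (0 : ℝ) 1) (u : ℝ) :
    jacobiDn (u + 2 * ellipticK r) r = jacobiDn u r := by
  rw [jacobiDn, jacobiSn_add_two_mul_ellipticK hr, neg_sq, jacobiDn]

lemma jacobiSn_neg (hr : r ∈ Set.Ico (0 : ℝ) 1) (u : ℝ) :
    jacobiSn (-u) r = -jacobiSn u r := by
  rw [jacobiSn, jacobiAm_neg hr, Real.sin_neg, jacobiSn]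

lemma jacobiDn_neg (hr : r ∈ Set.Ico (0 : ℝ) 1) (u : ℝ) :
    jacobiDn (-u) r = jacobiDn u r := by
  rw [jacobiDn, jacobiSn_neg hr, neg_sq, jacobiDn]

lemma jacobiSn_zero (hr : r ∈ Set.Ico (0 : ℝ) 1) : jacobiSn 0 r = 0 := by
  rw [jacobiSn, jacobiAm_zero hr, Real.sin_zero]

lemma jacobiDn_zero (hr : r ∈ Set.Ico (0 : ℝ) 1) : jacobiDn 0 r = 1 := by
  simp [jacobiDn, jacobiSn_zero hr]

lemma jacobiDn_pos (hr : r ∈ Set.Ico (0 : ℝ) 1) (u : ℝ) : 0 < jacobiDn u r :=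
  Real.sqrt_pos.2 (one_sub_mul_sin_sq_pos hr _)

lemma jacobiDn_sq (hr : r ∈ Set.Ico (0 : ℝ) 1) (u : ℝ) :
    jacobiDn u r ^ 2 = 1 - r * jacobiSn u r ^ 2 :=
  Real.sq_sqrt (one_sub_mul_sin_sq_pos hr _).le

/-- The zeros of `sn` are exactly the integer multiples of the half period `2 K`. -/
lemma jacobiSn_eq_zero_iff (hr : r ∈ Set.Ico (0 : ℝ) 1) (u : ℝ) :
    jacobiSn u r = 0 ↔ ∃ n : ℤ, u = n * (2 * ellipticK r) := by
  have hF : ∀ n : ℤ, ellipticF r (n * Real.pi) = n * (2 * ellipticK r) := by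
    intro n
    induction n using Int.induction_on with
    | zero => simp [ellipticF_zero]
    | succ n ih =>
      push_cast at ih ⊢
      rw [add_mul, one_mul, ellipticF_add_pi hr, ih]
      ring
    | pred n ih =>
      have h := ellipticF_add_pi hr (((-(n : ℤ) - 1 : ℤ) : ℝ) * Real.pi)
      rw [show ((-(n : ℤ) - 1 : ℤ) : ℝ) * Real.pi + Real.pi = ((-(n : ℤ) : ℤ) : ℝ) * Real.pi by
        push_cast; ring, ih] at h
      push_cast at h ⊢
      linarith
  rw [jacobiSn, Real.sin_eq_zero_iff]
  constructor
  · rintro ⟨n, hn⟩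
    exact ⟨n, by rw [← hF n, hn, ellipticF_jacobiAm hr]⟩
  · rintro ⟨n, hn⟩
    exact ⟨n, by rw [hn, ← hF n, jacobiAm_ellipticF hr]⟩

lemma contDiff_jacobiSn (hr : r ∈ Set.Ico (0 : ℝ) 1) :
    ContDiff ℝ ∞ fun u => jacobiSn u r :=
  Real.contDiff_sin.comp (contDiff_jacobiAm hr)

lemma contDiff_jacobiDn (hr : r ∈ Set.Ico (0 : ℝ) 1) :
    ContDiff ℝ ∞ fun u => jacobiDn u r := by
  have := contDiff_jacobiSn hr
  exact ContDiff.sqrt (by fun_prop) fun u => (one_sub_mul_sin_sq_pos hr _).ne'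

lemma hasDerivAt_jacobiSn (hr : r ∈ Set.Ico (0 : ℝ) 1) (u : ℝ) :
    HasDerivAt (fun u => jacobiSn u r) (Real.cos (jacobiAm r u) * jacobiDn u r) u :=
  (hasDerivAt_jacobiAm hr u).sin

lemma hasDerivAt_cos_jacobiAm (hr : r ∈ Set.Ico (0 : ℝ) 1) (u : ℝ) :
    HasDerivAt (fun u => Real.cos (jacobiAm r u)) (-jacobiSn u r * jacobiDn u r) u :=
  (hasDerivAt_jacobiAm hr u).cos

lemma hasDerivAt_jacobiDn (hr : r ∈ Set.Ico (0 : ℝ) 1) (u : ℝ) :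
    HasDerivAt (fun u => jacobiDn u r) (-(r * jacobiSn u r * Real.cos (jacobiAm r u))) u := by
  have h := ((((hasDerivAt_jacobiSn hr u).pow 2).const_mul r).const_sub 1).sqrt
    (one_sub_mul_sin_sq_pos hr _).ne'
  refine h.congr_deriv ?_
  have hd := (jacobiDn_pos hr u).ne'
  change _ / (2 * jacobiDn u r) = _
  field_simp
  simp only [Nat.cast_ofNat, Nat.add_one_sub_one, pow_one]
  ring

end Elliptic

/-! ### Quartic oscillators -/

/-- `f` solves the quartic first-order equation `f'² = c₀ + c₁ f² + c₂ f⁴`, with `g = f'`. The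
second-order equation `f'' = c₁ f + 2 c₂ f³` is a separate field, since it does not follow from the
first-order one at the points where `f'` vanishes. -/
structure QuarticOscillator (f g : ℝ → ℝ) (c₀ c₁ c₂ : ℝ) : Prop where
  contDiff : ContDiff ℝ ∞ f
  hasDerivAt : ∀ y, HasDerivAt f (g y) y
  hasDerivAt' : ∀ y, HasDerivAt g (c₁ * f y + 2 * c₂ * f y ^ 3) y
  energy : ∀ y, g y ^ 2 = c₀ + c₁ * f y ^ 2 + c₂ * f y ^ 4

lemma QuarticOscillator.shift {f g : ℝ → ℝ} {c₀ c₁ c₂ : ℝ} (h : QuarticOscillator f g c₀ c₁ c₂)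
    (p : ℝ) : QuarticOscillator (fun y => f (y + p)) (fun y => g (y + p)) c₀ c₁ c₂ where
  contDiff := by have := h.contDiff; fun_prop
  hasDerivAt y := (h.hasDerivAt (y + p)).comp_add_const y p
  hasDerivAt' y := (h.hasDerivAt' (y + p)).comp_add_const y p
  energy y := h.energy (y + p)

lemma QuarticOscillator.contDiff' {f g : ℝ → ℝ} {c₀ c₁ c₂ : ℝ}
    (h : QuarticOscillator f g c₀ c₁ c₂) : ContDiff ℝ ∞ g := by
  rw [← funext fun y => (h.hasDerivAt y).deriv]
  exact (contDiff_infty_iff_deriv.1 h.contDiff).2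

/-! ### The angle and its partial derivatives -/

/-- `∂₁ Θ` for `Θ(y₁, y₂) = arctan (s(y₁) d(y₂))`, as a function of the values of `s`, `c = s'` and
`d`. -/
noncomputable def angleDeriv₁ (s c d : ℝ) : ℝ := c * d / (1 + (s * d) ^ 2)

/-- `∂₂ Θ` for `Θ(y₁, y₂) = arctan (s(y₁) d(y₂))`, as a function of the values of `s`, `d` and
`e = d'`. -/
noncomputable def angleDeriv₂ (s d e : ℝ) : ℝ := s * e / (1 + (s * d) ^ 2)

/-- `∂₁∂₁ Θ` for `Θ(y₁, y₂) = arctan (s(y₁) d(y₂))`, where `s'' = c₁ s + 2 c₂ s³`. -/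
noncomputable def angleDeriv₁₁ (c₁ c₂ s c d : ℝ) : ℝ :=
  (c₁ * s + 2 * c₂ * s ^ 3) * d / (1 + (s * d) ^ 2)
    - 2 * (s * d) * (c * d) ^ 2 / (1 + (s * d) ^ 2) ^ 2

/-- `∂₁∂₂ Θ` for `Θ(y₁, y₂) = arctan (s(y₁) d(y₂))`. -/
noncomputable def angleDeriv₁₂ (s c d e : ℝ) : ℝ :=
  c * e / (1 + (s * d) ^ 2) - 2 * (s * d) * (c * d) * (s * e) / (1 + (s * d) ^ 2) ^ 2

/-- `∂₂∂₂ Θ` for `Θ(y₁, y₂) = arctan (s(y₁) d(y₂))`, where `d'' = c₁ d + 2 c₂ d³`. -/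
noncomputable def angleDeriv₂₂ (c₁ c₂ s d e : ℝ) : ℝ :=
  s * (c₁ * d + 2 * c₂ * d ^ 3) / (1 + (s * d) ^ 2)
    - 2 * (s * d) * (s * e) ^ 2 / (1 + (s * d) ^ 2) ^ 2

section Curve

-- `lam` and `mu` are the speeds at which the two phases move: `(1, 1)` along the `x`-axis and
-- `(δ, γ)` along the `t`-axis.
variable {a₁ a₂ b₁ b₂ lam mu x : ℝ} {s c d e : ℝ → ℝ}

lemma hasDerivAt_arctan_mul (hs : HasDerivAt s (lam * c x) x) (hd : HasDerivAt d (mu * e x) x) :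
    HasDerivAt (fun x => Real.arctan (s x * d x))
      (lam * angleDeriv₁ (s x) (c x) (d x) + mu * angleDeriv₂ (s x) (d x) (e x)) x := by
  refine (hs.mul hd).arctan.congr_deriv ?_
  simp only [angleDeriv₁, angleDeriv₂, Pi.mul_apply]
  have : 1 + (s x * d x) ^ 2 ≠ 0 := by positivity
  field_simp

lemma hasDerivAt_angleDeriv₁ (hs : HasDerivAt s (lam * c x) x)
    (hc : HasDerivAt c (lam * (a₁ * s x + 2 * a₂ * s x ^ 3)) x)
    (hd : HasDerivAt d (mu * e x) x) :
    HasDerivAt (fun x => angleDeriv₁ (s x) (c x) (d x))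
      (lam * angleDeriv₁₁ a₁ a₂ (s x) (c x) (d x)
        + mu * angleDeriv₁₂ (s x) (c x) (d x) (e x)) x := by
  have hD : 1 + (s x * d x) ^ 2 ≠ 0 := by positivity
  refine ((hc.mul hd).div (((hs.mul hd).pow 2).const_add 1) hD).congr_deriv ?_
  simp only [Pi.mul_apply, Pi.pow_apply, angleDeriv₁₁, angleDeriv₁₂]
  field_simp
  simp only [Nat.cast_ofNat, Nat.add_one_sub_one, pow_one]
  ring

lemma hasDerivAt_angleDeriv₂ (hs : HasDerivAt s (lam * c x) x)
    (hd : HasDerivAt d (mu * e x) x)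
    (he : HasDerivAt e (mu * (b₁ * d x + 2 * b₂ * d x ^ 3)) x) :
    HasDerivAt (fun x => angleDeriv₂ (s x) (d x) (e x))
      (lam * angleDeriv₁₂ (s x) (c x) (d x) (e x)
        + mu * angleDeriv₂₂ b₁ b₂ (s x) (d x) (e x)) x := by
  have hD : 1 + (s x * d x) ^ 2 ≠ 0 := by positivity
  refine ((hs.mul he).div (((hs.mul hd).pow 2).const_add 1) hD).congr_deriv ?_
  simp only [Pi.mul_apply, Pi.pow_apply, angleDeriv₂₂, angleDeriv₁₂]
  field_simp
  simp only [Nat.cast_ofNat, Nat.add_one_sub_one, pow_one]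
  ring

end Curve

/-! ### A closed differential system and its mKdV fluxes -/

/-- A polynomial differential system closed under `d/dx`, with three polynomial constraints.
It is satisfied by `P = ∂₁Θ`, `Q = ∂₂Θ`, `R = sin(4Θ)/4` and `T = sin²(2Θ)/4` when `Θ` is an angle
`arctan (s(y₁) d(y₂))` whose two oscillators are in resonance, and `M` is the common part of
`(∂₁ + ∂₂)∂₁Θ = M + A R` and `(∂₁ + ∂₂)∂₂Θ = M + B R`. -/
structure AngleSystem (P Q M R T : ℝ → ℝ) (A B κ : ℝ) : Prop where
  hasDerivAt_P : ∀ x, HasDerivAt P (M x + A * R x) x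
  hasDerivAt_Q : ∀ x, HasDerivAt Q (M x + B * R x) x
  hasDerivAt_M : ∀ x, HasDerivAt M (B * P x + A * Q x - 4 * (P x + Q x) ^ 3
    + 4 * (A + B) * (P x + Q x) * T x) x
  hasDerivAt_R : ∀ x, HasDerivAt R ((P x + Q x) * (1 - 8 * T x)) x
  R_sq : ∀ x, R x ^ 2 = T x * (1 - 4 * T x)
  mul_eq : ∀ x, P x * Q x = R x * M x + 2 * T x * ((P x + Q x) ^ 2 - (A + B) * T x)
  energy : ∀ x, M x ^ 2 + ((P x + Q x) ^ 2 - (A + B) * T x) ^ 2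
    = B * P x ^ 2 + A * Q x ^ 2 - A * B * T x - κ

section flux

variable {P Q M R T : ℝ → ℝ} {A B κ : ℝ}

/-- On a solution of the closed system, both fluxes of `u = 2 (P + Q)` are linear in `P` and `Q`.
With `v = u'' + 2 u³`, the field `u` satisfies the stationary equation
`flux5 u = 2 (A + B) v + (32 κ - (A - B)²) u`, and `flux7` differs from a combination of `flux5`,
`v` and `u` by `u` times a quantity that is constant on solutions. -/
lemma AngleSystem.flux_eq (h : AngleSystem P Q M R T A B κ) (x : ℝ) :
    flux5 (fun x => 2 * (P x + Q x)) x
        = (2 * A ^ 2 + 20 * A * B + 10 * B ^ 2 + 64 * κ) * P x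
          + (10 * A ^ 2 + 20 * A * B + 2 * B ^ 2 + 64 * κ) * Q x ∧
      flux7 (fun x => 2 * (P x + Q x)) x
        = (2 * A ^ 3 + 42 * A ^ 2 * B + 70 * A * B ^ 2 + 14 * B ^ 3
            + 320 * κ * A + 448 * κ * B) * P x
          + (14 * A ^ 3 + 70 * A ^ 2 * B + 42 * A * B ^ 2 + 2 * B ^ 3
            + 448 * κ * A + 320 * κ * B) * Q x := by
  set u : ℝ → ℝ := fun x => 2 * (P x + Q x) with hu
  set u1 : ℝ → ℝ := fun x => 2 * (2 * M x + (A + B) * R x) with hu1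
  set v : ℝ → ℝ := fun x => 4 * (B * P x + A * Q x) + (A + B) * u x with hv
  set v1 : ℝ → ℝ := fun x => 4 * ((A + B) * M x + 2 * (A * B) * R x) + (A + B) * u1 x with hv1
  set C1 := 2 * (A + B) with hC1
  set C2 := -(A - B) ^ 2 + 32 * κ with hC2
  have du : ∀ x, HasDerivAt u (u1 x) x := fun x =>
    (((h.hasDerivAt_P x).add (h.hasDerivAt_Q x)).const_mul 2).congr_deriv (by
      simp only [hu1]; ring)
  have du1 : ∀ x, HasDerivAt u1 (v x - 2 * u x ^ 3) x := fun x =>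
    ((((h.hasDerivAt_M x).const_mul 2).add ((h.hasDerivAt_R x).const_mul (A + B))).const_mul
      2).congr_deriv (by simp only [hv, hu]; ring)
  have dv : ∀ x, HasDerivAt v (v1 x) x := fun x =>
    (((((h.hasDerivAt_P x).const_mul B).add ((h.hasDerivAt_Q x).const_mul A)).const_mul 4).add
      ((du x).const_mul (A + B))).congr_deriv (by simp only [hv1]; ring)
  have dv1 : ∀ x, HasDerivAt v1
      (C1 * v x + C2 * u x - 4 * u x ^ 2 * v x + 2 * u x * (u1 x ^ 2 + u x ^ 4)) x := fun x =>
    (((((h.hasDerivAt_M x).const_mul (A + B)).add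
      ((h.hasDerivAt_R x).const_mul (2 * (A * B)))).const_mul 4).add
      ((du1 x).const_mul (A + B))).congr_deriv (by
        have e1 := h.R_sq x
        have e2 := h.mul_eq x
        have e3 := h.energy x
        simp only [hv, hu, hu1, hC1, hC2]
        linear_combination (-64 * (P x + Q x)) * e3
          + (64 * (A + B) * (P x + Q x)) * e2
          - 16 * (A + B) ^ 2 * (P x + Q x) * e1)
  have du2 : ∀ x, HasDerivAt (fun x => v x - 2 * u x ^ 3) (v1 x - 6 * u x ^ 2 * u1 x) x :=
    fun x => ((dv x).sub (((du x).pow 3).const_mul 2)).congr_deriv (by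
      simp only [Nat.cast_ofNat, Nat.add_one_sub_one]; ring)
  have du3 : ∀ x, HasDerivAt (fun x => v1 x - 6 * u x ^ 2 * u1 x)
      (C1 * v x + C2 * u x - 10 * u x ^ 2 * v x - 10 * u x * u1 x ^ 2 + 14 * u x ^ 5) x :=
    fun x => ((dv1 x).sub ((((du x).pow 2).const_mul 6).mul (du1 x))).congr_deriv (by
      simp only [Nat.cast_ofNat, Nat.add_one_sub_one, Pi.pow_apply]; ring)
  have du4 : ∀ x, HasDerivAt
      (fun x => C1 * v x + C2 * u x - 10 * u x ^ 2 * v x - 10 * u x * u1 x ^ 2 + 14 * u x ^ 5)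
      (C1 * v1 x + C2 * u1 x - 40 * u x * u1 x * v x - 10 * u x ^ 2 * v1 x - 10 * u1 x ^ 3
        + 110 * u x ^ 4 * u1 x) x :=
    fun x => ((((((dv x).const_mul C1).add ((du x).const_mul C2)).sub
      ((((du x).pow 2).const_mul 10).mul (dv x))).sub
      (((du x).const_mul 10).mul ((du1 x).pow 2))).add (((du x).pow 5).const_mul 14)).congr_deriv
      (by simp only [Nat.cast_ofNat, Nat.add_one_sub_one, Pi.pow_apply]; ring)
  have du5 : ∀ x, HasDerivAt
      (fun x => C1 * v1 x + C2 * u1 x - 40 * u x * u1 x * v x - 10 * u x ^ 2 * v1 x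
        - 10 * u1 x ^ 3 + 110 * u x ^ 4 * u1 x)
      (C1 * (C1 * v x + C2 * u x - 4 * u x ^ 2 * v x + 2 * u x * (u1 x ^ 2 + u x ^ 4))
        + C2 * (v x - 2 * u x ^ 3)
        - 40 * (u1 x ^ 2 * v x + u x * (v x - 2 * u x ^ 3) * v x + u x * u1 x * v1 x)
        - 20 * u x * u1 x * v1 x
        - 10 * u x ^ 2 * (C1 * v x + C2 * u x - 4 * u x ^ 2 * v x
          + 2 * u x * (u1 x ^ 2 + u x ^ 4))
        - 30 * u1 x ^ 2 * (v x - 2 * u x ^ 3) + 440 * u x ^ 3 * u1 x ^ 2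
        + 110 * u x ^ 4 * (v x - 2 * u x ^ 3)) x :=
    fun x => (((((((dv1 x).const_mul C1).add ((du1 x).const_mul C2)).sub
      ((((du x).const_mul 40).mul (du1 x)).mul (dv x))).sub
      ((((du x).pow 2).const_mul 10).mul (dv1 x))).sub (((du1 x).pow 3).const_mul 10)).add
      ((((du x).pow 4).const_mul 110).mul (du1 x))).congr_deriv (by
        simp only [Nat.cast_ofNat, Nat.add_one_sub_one, Pi.pow_apply, Pi.mul_apply]; ring)
  have i1 : deriv u = u1 := funext fun x => (du x).deriv
  have i2 := (funext fun x => (du1 x).deriv : deriv u1 = _)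
  have i3 := funext fun x => (du2 x).deriv
  have i4 := funext fun x => (du3 x).deriv
  have i5 := funext fun x => (du4 x).deriv
  have i6 := funext fun x => (du5 x).deriv
  have e1 := h.R_sq x
  have e2 := h.mul_eq x
  have e3 := h.energy x
  -- the conserved quantity of the stationary equation, whose value enters `flux7`
  have key : 16 * κ * (A + B) = C2 * u x ^ 2 / 2 + C1 * (u1 x ^ 2 + u x ^ 4) / 2 - u1 x * v1 x
      + u x ^ 2 * (u1 x ^ 2 + u x ^ 4) + v x ^ 2 / 2 - 2 * u x ^ 3 * v x := by
    simp only [hv, hv1, hu, hu1, hC1, hC2]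
    linear_combination (-16 * (4 * (P x + Q x) ^ 2 - (A + B))) * e3
      + (64 * (A + B) * (P x + Q x) ^ 2 - 32 * A * B - 8 * (A + B) ^ 2) * e2
      - (16 * (A + B) ^ 2 * (P x + Q x) ^ 2 - 16 * A * B * (A + B)) * e1
  have k5 : flux5 u x = C1 * v x + C2 * u x := by
    simp only [flux5, iteratedDeriv_succ, iteratedDeriv_zero, i1, i2, i3, i4]
    ring
  have k7 : flux7 u x = C1 * (C1 * v x + C2 * u x) + C2 * v x + 64 * κ * (A + B) * u x := by
    simp only [flux7, iteratedDeriv_succ, iteratedDeriv_zero, i1, i2, i3, i4, i5, i6]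
    linear_combination (-4 * u x) * key
  refine ⟨k5.trans ?_, k7.trans ?_⟩ <;> simp only [hv, hu, hC1, hC2] <;> ring

end flux

/-! ### Resonant oscillators form an angle system -/

section Resonance

variable {a₀ a₁ a₂ b₁ : ℝ} {s c d e : ℝ → ℝ}

/-- Resonance enters as a matching of the outer coefficients: the first oscillator
has coefficients `a₀, a₁, a₂` and the second `-a₂, b₁, -a₀`. Every identity is polynomial in
`s, c, d, e` modulo the two energy relations, whose multipliers are given explicitly. -/
lemma angleSystem_of_quarticOscillator (hs : QuarticOscillator s c a₀ a₁ a₂)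
    (hd : QuarticOscillator d e (-a₂) b₁ (-a₀)) :
    AngleSystem (fun x => angleDeriv₁ (s x) (c x) (d x)) (fun x => angleDeriv₂ (s x) (d x) (e x))
      (fun x => (c x * e x * (1 - (s x * d x) ^ 2)
        + 2 * (s x * d x) * (a₂ * s x ^ 2 - a₀ * d x ^ 2)) / (1 + (s x * d x) ^ 2) ^ 2)
      (fun x => s x * d x * (1 - (s x * d x) ^ 2) / (1 + (s x * d x) ^ 2) ^ 2)
      (fun x => (s x * d x) ^ 2 / (1 + (s x * d x) ^ 2) ^ 2) a₁ b₁ (a₀ * a₂) := by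
  have hs1 : ∀ x, HasDerivAt s (1 * c x) x := fun x => by simpa using hs.hasDerivAt x
  have hc1 : ∀ x, HasDerivAt c (1 * (a₁ * s x + 2 * a₂ * s x ^ 3)) x :=
    fun x => by simpa using hs.hasDerivAt' x
  have hd1 : ∀ x, HasDerivAt d (1 * e x) x := fun x => by simpa using hd.hasDerivAt x
  have he1 : ∀ x, HasDerivAt e (1 * (b₁ * d x + 2 * (-a₀) * d x ^ 3)) x :=
    fun x => by simpa using hd.hasDerivAt' x
  constructor
  · intro x
    refine (hasDerivAt_angleDeriv₁ (hs1 x) (hc1 x) (hd1 x)).congr_deriv ?_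
    have h1 := hs.energy x
    simp only [angleDeriv₁₁, angleDeriv₁₂]
    generalize s x = s at *
    generalize c x = c at *
    generalize d x = d at *
    generalize e x = e at *
    have hD : 1 + (s * d) ^ 2 ≠ 0 := by positivity
    field_simp
    linear_combination (-2 * s * d ^ 3) * h1
  · intro x
    refine (hasDerivAt_angleDeriv₂ (hs1 x) (hd1 x) (he1 x)).congr_deriv ?_
    have h2 := hd.energy x
    simp only [angleDeriv₁₂, angleDeriv₂₂]
    generalize s x = s at *
    generalize c x = c at *
    generalize d x = d at *
    generalize e x = e at *
    have hD : 1 + (s * d) ^ 2 ≠ 0 := by positivity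
    field_simp
    linear_combination (-2 * s ^ 3 * d) * h2
  · intro x
    have hf := (hs.hasDerivAt x).mul (hd.hasDerivAt x)
    have hD : (1 + (s x * d x) ^ 2) ^ 2 ≠ 0 := by positivity
    refine ((((((hs.hasDerivAt' x).mul (hd.hasDerivAt' x)).mul ((hf.pow 2).const_sub 1))).add
      ((hf.const_mul 2).mul ((((hs.hasDerivAt x).pow 2).const_mul a₂).sub
        (((hd.hasDerivAt x).pow 2).const_mul a₀)))).div
      (((hf.pow 2).const_add 1).pow 2) hD).congr_deriv ?_
    have h1 := hs.energy x
    have h2 := hd.energy x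
    simp only [angleDeriv₁, angleDeriv₂, Pi.mul_apply, Pi.pow_apply, Pi.add_apply, Pi.sub_apply]
    generalize s x = s at *
    generalize c x = c at *
    generalize d x = d at *
    generalize e x = e at *
    have hD : 1 + (s * d) ^ 2 ≠ 0 := by positivity
    field_simp
    simp only [Nat.cast_ofNat, Nat.add_one_sub_one, pow_one]
    linear_combination
      ((1 + (s * d) ^ 2) * d ^ 2 * (4 * (c * d + s * e) + 2 * (1 + (s * d) ^ 2) * (s * e))) * h1
      + ((1 + (s * d) ^ 2) * s ^ 2 * (4 * (c * d + s * e) + 2 * (1 + (s * d) ^ 2) * (c * d))) * h2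
  · intro x
    have hf := (hs.hasDerivAt x).mul (hd.hasDerivAt x)
    have hD : (1 + (s x * d x) ^ 2) ^ 2 ≠ 0 := by positivity
    refine ((hf.mul ((hf.pow 2).const_sub 1)).div
      (((hf.pow 2).const_add 1).pow 2) hD).congr_deriv ?_
    simp only [angleDeriv₁, angleDeriv₂, Pi.mul_apply, Pi.pow_apply]
    generalize s x = s at *
    generalize c x = c at *
    generalize d x = d at *
    generalize e x = e at *
    have hD : 1 + (s * d) ^ 2 ≠ 0 := by positivity
    field_simp
    simp only [Nat.cast_ofNat, Nat.add_one_sub_one, pow_one]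
    ring
  · intro x
    have hD : 1 + (s x * d x) ^ 2 ≠ 0 := by positivity
    field_simp
    ring
  · intro x
    have h1 := hs.energy x
    have h2 := hd.energy x
    simp only [angleDeriv₁, angleDeriv₂]
    generalize s x = s at *
    generalize c x = c at *
    generalize d x = d at *
    generalize e x = e at *
    have hD : 1 + (s * d) ^ 2 ≠ 0 := by positivity
    field_simp
    linear_combination (-2 * s ^ 2 * d ^ 4) * h1 - 2 * s ^ 4 * d ^ 2 * h2
  · intro x
    have h1 := hs.energy x
    have h2 := hd.energy x
    simp only [angleDeriv₁, angleDeriv₂]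
    generalize s x = s at *
    generalize c x = c at *
    generalize d x = d at *
    generalize e x = e at *
    have hD : 1 + (s * d) ^ 2 ≠ 0 := by positivity
    field_simp
    set H := ((c * d + s * e) ^ 2 - (a₁ + b₁) * (s * d) ^ 2)
      + (a₀ * d ^ 2 - a₂ * s ^ 2) * (1 - (s * d) ^ 2) + 2 * (s * d) * (c * e) with hH
    linear_combination
      ((1 + (s * d) ^ 2) ^ 2 * (e ^ 2 - b₁ * d ^ 2) + d ^ 2 * H) * h1
      + ((1 + (s * d) ^ 2) ^ 2 * (a₀ + a₂ * s ^ 4) + s ^ 2 * H) * h2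

end Resonance

/-! ### Breathers built from two oscillators -/

section Travelling

variable {a₀ a₁ a₂ b₀ b₁ b₂ : ℝ} {s c d e : ℝ → ℝ}

/-- The function `2 ∂ₓ arctan (s(y₁) d(y₂))` with `y₁ = x + δ t + x₁`, `y₂ = x + γ t + x₂`, where
`c = s'` and `e = d'`. -/
noncomputable def twoPhase (s c d e : ℝ → ℝ) (δ γ x₁ x₂ t x : ℝ) : ℝ :=
  2 * (angleDeriv₁ (s (x + δ * t + x₁)) (c (x + δ * t + x₁)) (d (x + γ * t + x₂))
    + angleDeriv₂ (s (x + δ * t + x₁)) (d (x + γ * t + x₂)) (e (x + γ * t + x₂)))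

/-- The function `2 ∂ₜ arctan (s(y₁) d(y₂))` with `y₁ = x + δ t + x₁`, `y₂ = x + γ t + x₂`, where
`c = s'` and `e = d'`. -/
noncomputable def twoPhaseFlow (s c d e : ℝ → ℝ) (δ γ x₁ x₂ t x : ℝ) : ℝ :=
  2 * (δ * angleDeriv₁ (s (x + δ * t + x₁)) (c (x + δ * t + x₁)) (d (x + γ * t + x₂))
    + γ * angleDeriv₂ (s (x + δ * t + x₁)) (d (x + γ * t + x₂)) (e (x + γ * t + x₂)))

lemma contDiff_twoPhase (hs : QuarticOscillator s c a₀ a₁ a₂) (hd : QuarticOscillator d e b₀ b₁ b₂)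
    (δ γ x₁ x₂ : ℝ) :
    ContDiff ℝ ∞ fun p : ℝ × ℝ => twoPhase s c d e δ γ x₁ x₂ p.1 p.2 := by
  have h1 := hs.contDiff
  have h2 := hs.contDiff'
  have h3 := hd.contDiff
  have h4 := hd.contDiff'
  unfold twoPhase angleDeriv₁ angleDeriv₂
  refine contDiff_const.mul (ContDiff.add (ContDiff.div ?_ ?_ fun p => by positivity)
    (ContDiff.div ?_ ?_ fun p => by positivity)) <;> fun_prop

lemma contDiff_twoPhase_apply (hs : QuarticOscillator s c a₀ a₁ a₂)
    (hd : QuarticOscillator d e b₀ b₁ b₂) (δ γ x₁ x₂ t : ℝ) :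
    ContDiff ℝ ∞ (twoPhase s c d e δ γ x₁ x₂ t) :=
  (contDiff_twoPhase hs hd δ γ x₁ x₂).comp (contDiff_const.prodMk contDiff_id)

lemma contDiff_twoPhaseFlow (hs : QuarticOscillator s c a₀ a₁ a₂)
    (hd : QuarticOscillator d e b₀ b₁ b₂) (δ γ x₁ x₂ t : ℝ) :
    ContDiff ℝ ∞ (twoPhaseFlow s c d e δ γ x₁ x₂ t) := by
  have h1 := hs.contDiff
  have h2 := hs.contDiff'
  have h3 := hd.contDiff
  have h4 := hd.contDiff'
  unfold twoPhaseFlow angleDeriv₁ angleDeriv₂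
  refine contDiff_const.mul (ContDiff.add (contDiff_const.mul (ContDiff.div ?_ ?_
    fun p => by positivity)) (contDiff_const.mul (ContDiff.div ?_ ?_ fun p => by positivity)))
    <;> fun_prop

/-- Equality of the mixed partial derivatives of `2 arctan (s(y₁) d(y₂))` in `t` and `x`. -/
lemma deriv_twoPhase_time (hs : QuarticOscillator s c a₀ a₁ a₂)
    (hd : QuarticOscillator d e b₀ b₁ b₂) (δ γ x₁ x₂ t x : ℝ) :
    deriv (fun τ => twoPhase s c d e δ γ x₁ x₂ τ x) t
      = deriv (twoPhaseFlow s c d e δ γ x₁ x₂ t) x := by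
  have shift_t : ∀ (f : ℝ → ℝ) (f' δ y : ℝ), HasDerivAt f f' (x + δ * t + y) →
      HasDerivAt (fun τ => f (x + δ * τ + y)) (δ * f') t := fun f f' δ y hf => by
    have hlin : HasDerivAt (fun τ : ℝ => x + δ * τ + y) δ t := by
      simpa using (((hasDerivAt_id t).const_mul δ).const_add x).add_const y
    exact (HasDerivAt.comp t hf hlin).congr_deriv (mul_comm _ _)
  have shift_x : ∀ (f : ℝ → ℝ) (f' δ y : ℝ), HasDerivAt f f' (x + δ * t + y) →
      HasDerivAt (fun z => f (z + δ * t + y)) (1 * f') x := fun f f' δ y hf => by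
    have hlin : HasDerivAt (fun z : ℝ => z + δ * t + y) 1 x := by
      simpa using ((hasDerivAt_id x).add_const (δ * t)).add_const y
    exact (HasDerivAt.comp x hf hlin).congr_deriv (mul_comm _ _)
  have hst := shift_t _ _ δ x₁ (hs.hasDerivAt (x + δ * t + x₁))
  have hct := shift_t _ _ δ x₁ (hs.hasDerivAt' (x + δ * t + x₁))
  have hdt := shift_t _ _ γ x₂ (hd.hasDerivAt (x + γ * t + x₂))
  have het := shift_t _ _ γ x₂ (hd.hasDerivAt' (x + γ * t + x₂))
  have hsx := shift_x _ _ δ x₁ (hs.hasDerivAt (x + δ * t + x₁))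
  have hcx := shift_x _ _ δ x₁ (hs.hasDerivAt' (x + δ * t + x₁))
  have hdx := shift_x _ _ γ x₂ (hd.hasDerivAt (x + γ * t + x₂))
  have hex := shift_x _ _ γ x₂ (hd.hasDerivAt' (x + γ * t + x₂))
  have ht := ((hasDerivAt_angleDeriv₁ (c := fun τ => c (x + δ * τ + x₁))
      (e := fun τ => e (x + γ * τ + x₂)) hst hct hdt).add
    (hasDerivAt_angleDeriv₂ (c := fun τ => c (x + δ * τ + x₁))
      (e := fun τ => e (x + γ * τ + x₂)) hst hdt het)).const_mul 2
  have hx := (((hasDerivAt_angleDeriv₁ (c := fun z => c (z + δ * t + x₁))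
      (e := fun z => e (z + γ * t + x₂)) hsx hcx hdx).const_mul δ).add
    ((hasDerivAt_angleDeriv₂ (c := fun z => c (z + δ * t + x₁))
      (e := fun z => e (z + γ * t + x₂)) hsx hdx hex).const_mul γ)).const_mul 2
  refine ht.deriv.trans (Eq.trans ?_ hx.deriv.symm)
  ring

lemma twoPhase_flux_eq (hs : QuarticOscillator s c a₀ a₁ a₂)
    (hd : QuarticOscillator d e (-a₂) b₁ (-a₀)) (δ γ x₁ x₂ t x : ℝ) :
    (δ = -(a₁ ^ 2 + 10 * a₁ * b₁ + 5 * b₁ ^ 2 + 32 * (a₀ * a₂)) →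
      γ = -(5 * a₁ ^ 2 + 10 * a₁ * b₁ + b₁ ^ 2 + 32 * (a₀ * a₂)) →
      flux5 (twoPhase s c d e δ γ x₁ x₂ t) x = -twoPhaseFlow s c d e δ γ x₁ x₂ t x) ∧
    (δ = -(a₁ ^ 3 + 21 * a₁ ^ 2 * b₁ + 35 * a₁ * b₁ ^ 2 + 7 * b₁ ^ 3
        + 160 * (a₀ * a₂) * a₁ + 224 * (a₀ * a₂) * b₁) →
      γ = -(7 * a₁ ^ 3 + 35 * a₁ ^ 2 * b₁ + 21 * a₁ * b₁ ^ 2 + b₁ ^ 3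
        + 224 * (a₀ * a₂) * a₁ + 160 * (a₀ * a₂) * b₁) →
      flux7 (twoPhase s c d e δ γ x₁ x₂ t) x = -twoPhaseFlow s c d e δ γ x₁ x₂ t x) := by
  have h := (angleSystem_of_quarticOscillator (hs.shift (δ * t + x₁))
    (hd.shift (γ * t + x₂))).flux_eq x
  simp only [← add_assoc] at h
  refine ⟨fun h1 h2 => h.1.trans ?_, fun h1 h2 => h.2.trans ?_⟩ <;>
  · rw [twoPhaseFlow]
    generalize angleDeriv₁ _ _ _ = p
    generalize angleDeriv₂ _ _ _ = q
    rw [h1, h2]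
    ring

lemma isSmoothSolution_of_flux_eq (hs : QuarticOscillator s c a₀ a₁ a₂)
    (hd : QuarticOscillator d e b₀ b₁ b₂) {Φ : (ℝ → ℝ) → ℝ → ℝ} {δ γ x₁ x₂ : ℝ}
    (h : ∀ t x, Φ (twoPhase s c d e δ γ x₁ x₂ t) x = -twoPhaseFlow s c d e δ γ x₁ x₂ t x) :
    IsSmoothSolution Φ (twoPhase s c d e δ γ x₁ x₂) := by
  refine ⟨contDiff_twoPhase hs hd δ γ x₁ x₂, fun t x => ?_⟩
  rw [deriv_twoPhase_time hs hd, funext (h t), deriv.fun_neg, add_neg_cancel]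

end Travelling

/-! ### The elliptic profiles and the sufficiency of resonance -/

section Profiles

variable {α β k m : ℝ}

lemma quarticOscillator_sn (hα : 0 < α) (hβ : 0 < β) (hk : k ∈ Set.Ico (0 : ℝ) 1) :
    QuarticOscillator (fun y => β / α * jacobiSn (α * y) k)
      (fun y => β * Real.cos (jacobiAm k (α * y)) * jacobiDn (α * y) k)
      (β ^ 2) (-α ^ 2 * (1 + k)) (k * α ^ 4 / β ^ 2) where
  contDiff := by have := contDiff_jacobiSn hk; fun_prop
  hasDerivAt y := by
    have hlin : HasDerivAt (fun y : ℝ => α * y) α y := by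
      simpa using (hasDerivAt_id y).const_mul α
    refine ((HasDerivAt.comp y (hasDerivAt_jacobiSn hk (α * y)) hlin).const_mul
      (β / α)).congr_deriv ?_
    field_simp
  hasDerivAt' y := by
    have hlin : HasDerivAt (fun y : ℝ => α * y) α y := by
      simpa using (hasDerivAt_id y).const_mul α
    refine (((HasDerivAt.comp y (hasDerivAt_cos_jacobiAm hk (α * y)) hlin).const_mul β).mul
      (HasDerivAt.comp y (hasDerivAt_jacobiDn hk (α * y)) hlin)).congr_deriv ?_
    have h1 := jacobiDn_sq hk (α * y)
    have h2 := Real.cos_sq' (jacobiAm k (α * y))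
    change _ = 1 - jacobiSn (α * y) k ^ 2 at h2
    simp only [Function.comp_apply]
    generalize jacobiDn (α * y) k = D at *
    generalize jacobiSn (α * y) k = S at *
    generalize Real.cos _ = C at *
    field_simp
    linear_combination (-S) * h1 - k * S * h2
  energy y := by
    have h1 := jacobiDn_sq hk (α * y)
    have h2 := Real.cos_sq' (jacobiAm k (α * y))
    change _ = 1 - jacobiSn (α * y) k ^ 2 at h2
    rw [mul_pow, mul_pow, h1, h2]
    field_simp
    ring

lemma quarticOscillator_dn (β : ℝ) (hm : m ∈ Set.Ico (0 : ℝ) 1) :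
    QuarticOscillator (fun y => jacobiDn (β * y) m)
      (fun y => -(β * m * jacobiSn (β * y) m * Real.cos (jacobiAm m (β * y))))
      (-β ^ 2 * (1 - m)) (β ^ 2 * (2 - m)) (-β ^ 2) where
  contDiff := by have := contDiff_jacobiDn hm; fun_prop
  hasDerivAt y := by
    have hlin : HasDerivAt (fun y : ℝ => β * y) β y := by
      simpa using (hasDerivAt_id y).const_mul β
    refine (HasDerivAt.comp y (hasDerivAt_jacobiDn hm (β * y)) hlin).congr_deriv ?_
    ring
  hasDerivAt' y := by
    have hlin : HasDerivAt (fun y : ℝ => β * y) β y := by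
      simpa using (hasDerivAt_id y).const_mul β
    refine (((HasDerivAt.comp y (hasDerivAt_jacobiSn hm (β * y)) hlin).const_mul (β * m)).mul
      (HasDerivAt.comp y (hasDerivAt_cos_jacobiAm hm (β * y)) hlin)).neg.congr_deriv ?_
    have h1 := jacobiDn_sq hm (β * y)
    have h2 := Real.cos_sq' (jacobiAm m (β * y))
    change _ = 1 - jacobiSn (β * y) m ^ 2 at h2
    simp only [Function.comp_apply]
    generalize jacobiDn (β * y) m = D at *
    generalize jacobiSn (β * y) m = S at *
    generalize Real.cos _ = C at *
    linear_combination (2 * β ^ 2 * D) * h1 - (β ^ 2 * m * D) * h2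
  energy y := by
    have h1 := jacobiDn_sq hm (β * y)
    have h2 := Real.cos_sq' (jacobiAm m (β * y))
    change _ = 1 - jacobiSn (β * y) m ^ 2 at h2
    rw [neg_sq, mul_pow, h2, show jacobiDn (β * y) m ^ 4 = (jacobiDn (β * y) m ^ 2) ^ 2 by ring,
      h1]
    ring

lemma breather_eq_twoPhase (hα : 0 < α) (hβ : 0 < β) (hk : k ∈ Set.Ico (0 : ℝ) 1)
    (hm : m ∈ Set.Ico (0 : ℝ) 1) (δ γ x₁ x₂ : ℝ) :
    breather α β k m δ γ x₁ x₂
      = twoPhase (fun y => β / α * jacobiSn (α * y) k)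
        (fun y => β * Real.cos (jacobiAm k (α * y)) * jacobiDn (α * y) k)
        (fun y => jacobiDn (β * y) m)
        (fun y => -(β * m * jacobiSn (β * y) m * Real.cos (jacobiAm m (β * y)))) δ γ x₁ x₂ := by
  funext t x
  have h1 := ((quarticOscillator_sn hα hβ hk).shift (δ * t + x₁)).hasDerivAt x
  have h2 := ((quarticOscillator_dn β hm).shift (γ * t + x₂)).hasDerivAt x
  have h := (hasDerivAt_arctan_mul (lam := 1) (mu := 1)
    (c := fun x => β * Real.cos (jacobiAm k (α * (x + (δ * t + x₁))))
      * jacobiDn (α * (x + (δ * t + x₁))) k)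
    (e := fun x => -(β * m * jacobiSn (β * (x + (γ * t + x₂))) m
      * Real.cos (jacobiAm m (β * (x + (γ * t + x₂))))))
    (h1.congr_deriv (one_mul _).symm) (h2.congr_deriv (one_mul _).symm)).deriv
  simp only [one_mul, ← add_assoc] at h
  rw [breather, twoPhase, ← h]
  congr 2
  funext z
  rw [jacobiNd, div_div_eq_mul_div, div_one, mul_assoc]

/-- The condition on the parameters says that the coefficient of the fourth power for the `sn`
profile is opposite to the constant coefficient for the `dn` profile. -/
lemma resonance_iff (hα : 0 < α) (hβ : 0 < β) (hm : m < 1) :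
    β ^ 4 / α ^ 4 = k / (1 - m) ↔ k * α ^ 4 / β ^ 2 = β ^ 2 * (1 - m) := by
  have : 1 - m ≠ 0 := by linarith
  have := hα.ne'
  have := hβ.ne'
  rw [div_eq_div_iff (by positivity) (by assumption), div_eq_iff (by positivity)]
  constructor <;> intro h <;> linear_combination -h

lemma solves_of_resonance (hα : 0 < α) (hβ : 0 < β) (hk : k ∈ Set.Ico (0 : ℝ) 1)
    (hm : m ∈ Set.Ico (0 : ℝ) 1) (h : β ^ 4 / α ^ 4 = k / (1 - m)) (x₁ x₂ : ℝ) :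
    SolvesMKdV5 (breather α β k m (delta5 α β k m) (gamma5 α β k m) x₁ x₂) ∧
      SolvesMKdV7 (breather α β k m (delta7 α β k m) (gamma7 α β k m) x₁ x₂) := by
  have hres := (resonance_iff hα hβ hm.2).1 h
  have hs := quarticOscillator_sn hα hβ hk
  have hd := quarticOscillator_dn β hm
  have hβ' := hβ.ne'
  have hα' := hα.ne'
  have hk' : k = β ^ 4 * (1 - m) / α ^ 4 := by
    rw [div_eq_iff (by positivity)] at hres
    rw [eq_div_iff (by positivity)]
    linear_combination hres
  have hd' := hd
  rw [neg_mul, ← hres] at hd'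
  rw [breather_eq_twoPhase hα hβ hk hm, breather_eq_twoPhase hα hβ hk hm]
  constructor <;> refine isSmoothSolution_of_flux_eq hs hd fun t x => ?_
  · refine (twoPhase_flux_eq hs hd' _ _ x₁ x₂ t x).1 ?_ ?_ <;>
    · simp only [delta5, gamma5]
      rw [hk']
      field_simp
      ring
  · refine (twoPhase_flux_eq hs hd' _ _ x₁ x₂ t x).2 ?_ ?_ <;>
    · simp only [delta7, gamma7]
      rw [hk']
      field_simp
      ring

end Profiles

/-! ### Taylor coefficients at the origin -/

/-- The `n`-th Taylor coefficient of `f` at `0`. -/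
noncomputable def taylorCoeff (n : ℕ) (f : ℝ → ℝ) : ℝ := iteratedDeriv n f 0 / n.factorial

section TaylorCoeff

variable {f g : ℝ → ℝ}

lemma taylorCoeff_zero (f : ℝ → ℝ) : taylorCoeff 0 f = f 0 := by simp [taylorCoeff]

lemma taylorCoeff_add (hf : ContDiff ℝ ∞ f) (hg : ContDiff ℝ ∞ g) (n : ℕ) :
    taylorCoeff n (fun x => f x + g x) = taylorCoeff n f + taylorCoeff n g := by
  rw [taylorCoeff, iteratedDeriv_fun_add (hf.of_le (mod_cast le_top)).contDiffAt
    (hg.of_le (mod_cast le_top)).contDiffAt, add_div]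
  rfl

lemma taylorCoeff_const_mul (c : ℝ) (f : ℝ → ℝ) (n : ℕ) :
    taylorCoeff n (fun x => c * f x) = c * taylorCoeff n f := by
  rw [taylorCoeff, iteratedDeriv_const_mul_field, mul_div_assoc]
  rfl

lemma taylorCoeff_mul (hf : ContDiff ℝ ∞ f) (hg : ContDiff ℝ ∞ g) (n : ℕ) :
    taylorCoeff n (fun x => f x * g x)
      = ∑ i ∈ Finset.range (n + 1), taylorCoeff i f * taylorCoeff (n - i) g := by
  rw [taylorCoeff, iteratedDeriv_fun_mul (hf.of_le (mod_cast le_top)).contDiffAt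
    (hg.of_le (mod_cast le_top)).contDiffAt, Finset.sum_div]
  refine Finset.sum_congr rfl fun i hi => ?_
  have hi : i ≤ n := Nat.lt_succ_iff.1 (Finset.mem_range.1 hi)
  rw [Nat.cast_choose ℝ hi, taylorCoeff, taylorCoeff]
  have h1 : (i.factorial : ℝ) ≠ 0 := by positivity
  have h2 : ((n - i).factorial : ℝ) ≠ 0 := by positivity
  have h3 : (n.factorial : ℝ) ≠ 0 := by positivity
  field_simp

lemma taylorCoeff_deriv (f : ℝ → ℝ) (n : ℕ) :
    taylorCoeff n (deriv f) = (n + 1) * taylorCoeff (n + 1) f := by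
  rw [taylorCoeff, taylorCoeff, ← iteratedDeriv_succ', Nat.factorial_succ]
  push_cast
  field_simp

lemma taylorCoeff_iteratedDeriv_succ (f : ℝ → ℝ) (k n : ℕ) :
    taylorCoeff n (iteratedDeriv (k + 1) f)
      = (n + 1) * taylorCoeff (n + 1) (iteratedDeriv k f) := by
  rw [iteratedDeriv_succ, taylorCoeff_deriv]

lemma taylorCoeff_of_even (hf : ∀ x, f (-x) = f x) {n : ℕ} (hn : Odd n) :
    taylorCoeff n f = 0 := by
  have h := iteratedDeriv_comp_neg n f 0
  rw [funext hf, neg_zero, hn.neg_one_pow, smul_eq_mul] at h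
  rw [taylorCoeff, show iteratedDeriv n f 0 = 0 by linarith, zero_div]

lemma taylorCoeff_of_odd (hf : ∀ x, f (-x) = -f x) {n : ℕ} (hn : Even n) :
    taylorCoeff n f = 0 := by
  have h := iteratedDeriv_comp_neg n f 0
  rw [funext hf, neg_zero, hn.neg_one_pow, smul_eq_mul, iteratedDeriv_fun_neg] at h
  rw [taylorCoeff, show iteratedDeriv n f 0 = 0 by linarith, zero_div]

lemma contDiff_iteratedDeriv (hf : ContDiff ℝ ∞ f) (k : ℕ) :
    ContDiff ℝ ∞ fun x => iteratedDeriv k f x := by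
  induction k with
  | zero => simpa using hf
  | succ k ih => rw [iteratedDeriv_succ]; exact (contDiff_infty_iff_deriv.1 ih).2

end TaylorCoeff

section Flux

variable {u : ℝ → ℝ}

lemma contDiff_flux5 (hu : ContDiff ℝ ∞ u) : ContDiff ℝ ∞ (flux5 u) := by
  have h1 := contDiff_iteratedDeriv hu 1
  have h2 := contDiff_iteratedDeriv hu 2
  have h4 := contDiff_iteratedDeriv hu 4
  simp only [iteratedDeriv_one] at h1
  unfold flux5
  fun_prop

lemma contDiff_flux7 (hu : ContDiff ℝ ∞ u) : ContDiff ℝ ∞ (flux7 u) := by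
  have h1 := contDiff_iteratedDeriv hu 1
  have h2 := contDiff_iteratedDeriv hu 2
  have h3 := contDiff_iteratedDeriv hu 3
  have h4 := contDiff_iteratedDeriv hu 4
  have h6 := contDiff_iteratedDeriv hu 6
  simp only [iteratedDeriv_one] at h1
  unfold flux7
  fun_prop

lemma taylorCoeff_two_flux5 (hu : ContDiff ℝ ∞ u) (hev : ∀ x, u (-x) = u x) :
    taylorCoeff 2 (flux5 u) = 360 * taylorCoeff 6 u
      + 80 * taylorCoeff 0 u * taylorCoeff 2 u ^ 2 + 120 * taylorCoeff 0 u ^ 2 * taylorCoeff 4 u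
      + 30 * taylorCoeff 0 u ^ 4 * taylorCoeff 2 u := by
  have h1 := contDiff_iteratedDeriv hu 1
  have h2 := contDiff_iteratedDeriv hu 2
  have h4 := contDiff_iteratedDeriv hu 4
  have e1 : taylorCoeff 1 u = 0 := taylorCoeff_of_even hev (by decide)
  have e3 : taylorCoeff 3 u = 0 := taylorCoeff_of_even hev (by decide)
  unfold flux5
  simp only [← iteratedDeriv_one (f := u)]
  simp only [pow_succ, pow_zero, one_mul, mul_assoc]
  simp (disch := fun_prop) only [taylorCoeff_add, taylorCoeff_const_mul, taylorCoeff_mul,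
    Finset.sum_range_succ, Finset.sum_range_zero, taylorCoeff_iteratedDeriv_succ,
    iteratedDeriv_zero, Nat.reduceAdd, Nat.reduceSub, Nat.sub_zero, Nat.sub_self, zero_add,
    e1, e3, mul_zero, zero_mul, add_zero]
  norm_num
  ring

lemma taylorCoeff_two_flux7 (hu : ContDiff ℝ ∞ u) (hev : ∀ x, u (-x) = u x) :
    taylorCoeff 2 (flux7 u) = 20160 * taylorCoeff 8 u
      + 5040 * taylorCoeff 0 u ^ 2 * taylorCoeff 6 u
      + 5376 * taylorCoeff 0 u * taylorCoeff 2 u * taylorCoeff 4 u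
      + 728 * taylorCoeff 2 u ^ 3 + 840 * taylorCoeff 0 u ^ 4 * taylorCoeff 4 u
      + 1120 * taylorCoeff 0 u ^ 3 * taylorCoeff 2 u ^ 2
      + 140 * taylorCoeff 0 u ^ 6 * taylorCoeff 2 u := by
  have h1 := contDiff_iteratedDeriv hu 1
  have h2 := contDiff_iteratedDeriv hu 2
  have h3 := contDiff_iteratedDeriv hu 3
  have h4 := contDiff_iteratedDeriv hu 4
  have h6 := contDiff_iteratedDeriv hu 6
  have e1 : taylorCoeff 1 u = 0 := taylorCoeff_of_even hev (by decide)
  have e3 : taylorCoeff 3 u = 0 := taylorCoeff_of_even hev (by decide)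
  have e5 : taylorCoeff 5 u = 0 := taylorCoeff_of_even hev (by decide)
  unfold flux7
  simp only [← iteratedDeriv_one (f := u)]
  simp only [pow_succ, pow_zero, one_mul, mul_assoc]
  simp (disch := fun_prop) only [taylorCoeff_add, taylorCoeff_const_mul, taylorCoeff_mul,
    Finset.sum_range_succ, Finset.sum_range_zero, taylorCoeff_iteratedDeriv_succ,
    iteratedDeriv_zero, Nat.reduceAdd, Nat.reduceSub, Nat.sub_zero, Nat.sub_self, zero_add,
    e1, e3, e5, mul_zero, zero_mul, add_zero]
  norm_num
  ring

end Flux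

/-! ### Taylor expansion of a breather at the origin -/

section Jets

variable {σ a₁ a₂ b₀ b₁ : ℝ} {s c d e : ℝ → ℝ}

lemma QuarticOscillator.taylorCoeff_succ_succ {f g : ℝ → ℝ} {c₀ c₁ c₂ : ℝ}
    (h : QuarticOscillator f g c₀ c₁ c₂) (n : ℕ) :
    (n + 1) * ((n + 2) * taylorCoeff (n + 2) f)
      = c₁ * taylorCoeff n f + 2 * c₂ * taylorCoeff n (fun y => f y * (f y * f y)) := by
  have hf := h.contDiff
  have h1 : deriv f = g := funext fun y => (h.hasDerivAt y).deriv
  have h2 : deriv g = fun y => c₁ * f y + 2 * c₂ * (f y * (f y * f y)) :=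
    funext fun y => (h.hasDerivAt' y).deriv.trans (by ring)
  have h3 := taylorCoeff_deriv (deriv f) n
  rw [taylorCoeff_deriv f (n + 1), h1, h2, taylorCoeff_add (by fun_prop) (by fun_prop),
    taylorCoeff_const_mul, taylorCoeff_const_mul] at h3
  rw [h3]
  push_cast
  ring

/-- The expansion at the origin of the breather with both phases zero, without any resonance
assumption: the last coefficient of the second oscillator is `-σ²`, where `σ = s'(0)`, but its
constant coefficient `b₀` is free. -/
lemma taylorCoeff_twoPhase (hs : QuarticOscillator s c (σ ^ 2) a₁ a₂)
    (hd : QuarticOscillator d e b₀ b₁ (-σ ^ 2)) (hs_odd : ∀ y, s (-y) = -s y)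
    (hd_even : ∀ y, d (-y) = d y) (hc0 : c 0 = σ) (hd0 : d 0 = 1) {u : ℝ → ℝ}
    (hu : ∀ x, u x = 2 * (angleDeriv₁ (s x) (c x) (d x) + angleDeriv₂ (s x) (d x) (e x)))
    (hu' : ContDiff ℝ ∞ u) :
    taylorCoeff 0 u = 2 * σ ∧
    taylorCoeff 2 u = σ * (-8 * σ ^ 2 + a₁ + 3 * b₁) ∧
    taylorCoeff 4 u = σ * (204 * σ ^ 4 - 40 * σ ^ 2 * a₁ - 100 * σ ^ 2 * b₁ + 12 * σ ^ 2 * a₂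
      + a₁ ^ 2 + 10 * a₁ * b₁ + 5 * b₁ ^ 2) / 12 ∧
    taylorCoeff 6 u = σ * (-14832 * σ ^ 6 + 3780 * σ ^ 4 * a₁ + 10668 * σ ^ 4 * b₁
      - 1008 * σ ^ 4 * a₂ - 224 * σ ^ 2 * a₁ ^ 2 - 1540 * σ ^ 2 * a₁ * b₁ + 132 * σ ^ 2 * a₁ * a₂
      - 1820 * σ ^ 2 * b₁ ^ 2 + 252 * σ ^ 2 * b₁ * a₂ + a₁ ^ 3 + 21 * a₁ ^ 2 * b₁
      + 35 * a₁ * b₁ ^ 2 + 7 * b₁ ^ 3) / 360 ∧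
    taylorCoeff 8 u = σ * (1966608 * σ ^ 8 - 653184 * σ ^ 6 * a₁ - 1813536 * σ ^ 6 * b₁
      + 163296 * σ ^ 6 * a₂ + 64008 * σ ^ 4 * a₁ ^ 2 + 410256 * σ ^ 4 * a₁ * b₁
      - 31104 * σ ^ 4 * a₁ * a₂ + 494136 * σ ^ 4 * b₁ ^ 2 - 66528 * σ ^ 4 * b₁ * a₂
      + 3024 * σ ^ 4 * a₂ ^ 2 - 1712 * σ ^ 2 * a₁ ^ 3 - 20664 * σ ^ 2 * a₁ ^ 2 * b₁
      + 1224 * σ ^ 2 * a₁ ^ 2 * a₂ - 57120 * σ ^ 2 * a₁ * b₁ ^ 2 + 4752 * σ ^ 2 * a₁ * b₁ * a₂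
      - 34488 * σ ^ 2 * b₁ ^ 3 + 1512 * σ ^ 2 * b₁ ^ 2 * a₂ + a₁ ^ 4 + 36 * a₁ ^ 3 * b₁
      + 126 * a₁ ^ 2 * b₁ ^ 2 + 84 * a₁ * b₁ ^ 3 + 9 * b₁ ^ 4) / 20160 := by
  have ks := hs.contDiff
  have kd := hd.contDiff
  have s0 : taylorCoeff 0 s = 0 := taylorCoeff_of_odd hs_odd (by decide)
  have s2 : taylorCoeff 2 s = 0 := taylorCoeff_of_odd hs_odd (by decide)
  have s4 : taylorCoeff 4 s = 0 := taylorCoeff_of_odd hs_odd (by decide)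
  have s6 : taylorCoeff 6 s = 0 := taylorCoeff_of_odd hs_odd (by decide)
  have s8 : taylorCoeff 8 s = 0 := taylorCoeff_of_odd hs_odd (by decide)
  have d1 : taylorCoeff 1 d = 0 := taylorCoeff_of_even hd_even (by decide)
  have d3 : taylorCoeff 3 d = 0 := taylorCoeff_of_even hd_even (by decide)
  have d5 : taylorCoeff 5 d = 0 := taylorCoeff_of_even hd_even (by decide)
  have d7 : taylorCoeff 7 d = 0 := taylorCoeff_of_even hd_even (by decide)
  have d9 : taylorCoeff 9 d = 0 := taylorCoeff_of_even hd_even (by decide)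
  have d0 : taylorCoeff 0 d = 1 := by rw [taylorCoeff_zero, hd0]
  have s1 : taylorCoeff 1 s = σ := by
    have h := taylorCoeff_deriv s 0
    rw [taylorCoeff_zero, (hs.hasDerivAt 0).deriv, hc0] at h
    simpa using h.symm
  have rs := hs.taylorCoeff_succ_succ
  have rd := hd.taylorCoeff_succ_succ
  -- recursions for the nonzero coefficients of `s`, `d`, `f = s d` and `u`
  have s3 := rs 1
  have s5 := rs 3
  have s7 := rs 5
  have s9 := rs 7
  have d2 := rd 0
  have d4 := rd 2
  have d6 := rd 4
  have d8 := rd 6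
  have hf : ContDiff ℝ ∞ fun x => s x * d x := by fun_prop
  have hf_odd : ∀ x, (fun x => s x * d x) (-x) = -(fun x => s x * d x) x := fun x => by
    simp [hs_odd, hd_even]
  set f : ℝ → ℝ := fun x => s x * d x with hfdef
  have f0 : taylorCoeff 0 f = 0 := taylorCoeff_of_odd hf_odd (by decide)
  have f2 : taylorCoeff 2 f = 0 := taylorCoeff_of_odd hf_odd (by decide)
  have f4 : taylorCoeff 4 f = 0 := taylorCoeff_of_odd hf_odd (by decide)
  have f6 : taylorCoeff 6 f = 0 := taylorCoeff_of_odd hf_odd (by decide)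
  have f8 : taylorCoeff 8 f = 0 := taylorCoeff_of_odd hf_odd (by decide)
  have f1 : taylorCoeff 1 f = _ := taylorCoeff_mul ks kd 1
  have f3 : taylorCoeff 3 f = _ := taylorCoeff_mul ks kd 3
  have f5 : taylorCoeff 5 f = _ := taylorCoeff_mul ks kd 5
  have f7 : taylorCoeff 7 f = _ := taylorCoeff_mul ks kd 7
  have f9 : taylorCoeff 9 f = _ := taylorCoeff_mul ks kd 9
  -- `u (1 + f²) = 2 f'` determines the coefficients of `u`
  have hmul : deriv f = fun x => 2⁻¹ * u x + 2⁻¹ * (u x * (f x * f x)) := funext fun x => by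
    refine ((hs.hasDerivAt x).mul (hd.hasDerivAt x)).deriv.trans ?_
    rw [hu, angleDeriv₁, angleDeriv₂]
    have : 1 + (s x * d x) ^ 2 ≠ 0 := by positivity
    simp only [hfdef]
    field_simp
  have ru : ∀ n : ℕ, (n + 1) * taylorCoeff (n + 1) f = 2⁻¹ * taylorCoeff n u
      + 2⁻¹ * taylorCoeff n (fun x => u x * (f x * f x)) := fun n => by
    rw [← taylorCoeff_deriv, hmul, taylorCoeff_add (by fun_prop) (by fun_prop),
      taylorCoeff_const_mul, taylorCoeff_const_mul]
  have u0 := ru 0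
  have u2 := ru 2
  have u4 := ru 4
  have u6 := ru 6
  have u8 := ru 8
  simp (disch := fun_prop) only [taylorCoeff_mul, Finset.sum_range_succ, Finset.sum_range_zero,
    Nat.reduceAdd, Nat.reduceSub, Nat.sub_zero, Nat.sub_self, zero_add, add_zero, mul_zero,
    zero_mul, one_mul, mul_one, s0, s1, s2, s4, s6, s8, d0, d1, d3, d5, d7, d9, f0, f2, f4, f6, f8,
    Nat.cast_ofNat, Nat.cast_zero, Nat.cast_one]
    at s3 s5 s7 s9 d2 d4 d6 d8 f1 f3 f5 f7 f9 u0 u2 u4 u6 u8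
  replace s3 : taylorCoeff 3 s = σ * a₁ / 6 := by
    linear_combination s3 / 6
  simp only [s3] at s5
  replace s5 : taylorCoeff 5 s = σ * (12 * σ ^ 2 * a₂ + a₁ ^ 2) / 120 := by
    linear_combination s5 / 20
  simp only [s3, s5] at s7
  replace s7 : taylorCoeff 7 s = σ * (132 * σ ^ 2 * a₁ * a₂ + a₁ ^ 3) / 5040 := by
    linear_combination s7 / 42
  simp only [s3, s5, s7] at s9
  replace s9 : taylorCoeff 9 s = σ * (3024 * σ ^ 4 * a₂ ^ 2
      + 1224 * σ ^ 2 * a₁ ^ 2 * a₂ + a₁ ^ 4) / 362880 := by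
    linear_combination s9 / 72
  replace d2 : taylorCoeff 2 d = (-2 * σ ^ 2 + b₁) / 2 := by
    linear_combination d2 / 2
  simp only [d2] at d4
  replace d4 : taylorCoeff 4 d = (12 * σ ^ 4 - 8 * σ ^ 2 * b₁ + b₁ ^ 2) / 24 := by
    linear_combination d4 / 12
  simp only [d2, d4] at d6
  replace d6 : taylorCoeff 6 d = (-216 * σ ^ 6 + 204 * σ ^ 4 * b₁
      - 50 * σ ^ 2 * b₁ ^ 2 + b₁ ^ 3) / 720 := by
    linear_combination d6 / 30
  simp only [d2, d4, d6] at d8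
  replace d8 : taylorCoeff 8 d = (7056 * σ ^ 8 - 8640 * σ ^ 6 * b₁
      + 3384 * σ ^ 4 * b₁ ^ 2 - 416 * σ ^ 2 * b₁ ^ 3 + b₁ ^ 4) / 40320 := by
    linear_combination d8 / 56
  simp only [s3, d2] at f3
  replace f3 : taylorCoeff 3 f = σ * (-6 * σ ^ 2 + a₁ + 3 * b₁) / 6 := by
    linear_combination f3
  simp only [s3, s5, d2, d4] at f5
  replace f5 : taylorCoeff 5 f = σ * (60 * σ ^ 4 - 20 * σ ^ 2 * a₁
      - 40 * σ ^ 2 * b₁ + 12 * σ ^ 2 * a₂ + a₁ ^ 2 + 10 * a₁ * b₁ + 5 * b₁ ^ 2) / 120 := by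
    linear_combination f5
  simp only [s3, s5, s7, d2, d4, d6] at f7
  replace f7 : taylorCoeff 7 f = σ * (-1512 * σ ^ 6 + 420 * σ ^ 4 * a₁
      + 1428 * σ ^ 4 * b₁ - 504 * σ ^ 4 * a₂ - 42 * σ ^ 2 * a₁ ^ 2 - 280 * σ ^ 2 * a₁ * b₁
      + 132 * σ ^ 2 * a₁ * a₂ - 350 * σ ^ 2 * b₁ ^ 2 + 252 * σ ^ 2 * b₁ * a₂ + a₁ ^ 3
      + 21 * a₁ ^ 2 * b₁ + 35 * a₁ * b₁ ^ 2 + 7 * b₁ ^ 3) / 5040 := by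
    linear_combination f7
  simp only [s3, s5, s7, s9, d2, d4, d6, d8] at f9
  replace f9 : taylorCoeff 9 f = σ * (63504 * σ ^ 8 - 18144 * σ ^ 6 * a₁
      - 77760 * σ ^ 6 * b₁ + 18144 * σ ^ 6 * a₂ + 1512 * σ ^ 4 * a₁ ^ 2
      + 17136 * σ ^ 4 * a₁ * b₁ - 9504 * σ ^ 4 * a₁ * a₂ + 30456 * σ ^ 4 * b₁ ^ 2
      - 12096 * σ ^ 4 * b₁ * a₂ + 3024 * σ ^ 4 * a₂ ^ 2 - 72 * σ ^ 2 * a₁ ^ 3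
      - 1008 * σ ^ 2 * a₁ ^ 2 * b₁ + 1224 * σ ^ 2 * a₁ ^ 2 * a₂ - 4200 * σ ^ 2 * a₁ * b₁ ^ 2
      + 4752 * σ ^ 2 * a₁ * b₁ * a₂ - 3744 * σ ^ 2 * b₁ ^ 3 + 1512 * σ ^ 2 * b₁ ^ 2 * a₂
      + a₁ ^ 4 + 36 * a₁ ^ 3 * b₁ + 126 * a₁ ^ 2 * b₁ ^ 2 + 84 * a₁ * b₁ ^ 3 + 9 * b₁ ^ 4) /
      362880 := by
    linear_combination f9
  simp only [f1] at u0
  replace u0 : taylorCoeff 0 u = 2 * σ := by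
    linear_combination (-2) * u0
  simp only [u0, f1, f3] at u2
  replace u2 : taylorCoeff 2 u = σ * (-8 * σ ^ 2 + a₁ + 3 * b₁) := by
    linear_combination (-2) * u2
  simp only [u0, u2, f1, f3, f5] at u4
  replace u4 : taylorCoeff 4 u = σ * (204 * σ ^ 4 - 40 * σ ^ 2 * a₁
      - 100 * σ ^ 2 * b₁ + 12 * σ ^ 2 * a₂ + a₁ ^ 2 + 10 * a₁ * b₁ + 5 * b₁ ^ 2) / 12 := by
    linear_combination (-2) * u4
  simp only [u0, u2, u4, f1, f3, f5, f7] at u6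
  replace u6 : taylorCoeff 6 u = σ * (-14832 * σ ^ 6 + 3780 * σ ^ 4 * a₁
      + 10668 * σ ^ 4 * b₁ - 1008 * σ ^ 4 * a₂ - 224 * σ ^ 2 * a₁ ^ 2 - 1540 * σ ^ 2 * a₁ * b₁
      + 132 * σ ^ 2 * a₁ * a₂ - 1820 * σ ^ 2 * b₁ ^ 2 + 252 * σ ^ 2 * b₁ * a₂ + a₁ ^ 3
      + 21 * a₁ ^ 2 * b₁ + 35 * a₁ * b₁ ^ 2 + 7 * b₁ ^ 3) / 360 := by
    linear_combination (-2) * u6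
  simp only [u0, u2, u4, u6, f1, f3, f5, f7, f9] at u8
  exact ⟨u0, u2, u4, u6, by linear_combination (-2) * u8⟩

lemma taylorCoeff_two_twoPhaseFlow (hs : QuarticOscillator s c (σ ^ 2) a₁ a₂)
    (hd : QuarticOscillator d e b₀ b₁ (-σ ^ 2)) (hs_odd : ∀ y, s (-y) = -s y)
    (hd_even : ∀ y, d (-y) = d y) (hc0 : c 0 = σ) (hd0 : d 0 = 1) (δ γ : ℝ) :
    taylorCoeff 2 (twoPhaseFlow s c d e δ γ 0 0 0)
      = δ * (σ * (a₁ + b₁ - 4 * σ ^ 2)) + γ * (2 * (σ * (b₁ - 2 * σ ^ 2))) := by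
  have ks := hs.contDiff
  have kd := hd.contDiff
  have ks' := hs.contDiff'
  have kd' := hd.contDiff'
  have s0 : taylorCoeff 0 s = 0 := taylorCoeff_of_odd hs_odd (by decide)
  have s2 : taylorCoeff 2 s = 0 := taylorCoeff_of_odd hs_odd (by decide)
  have d1 : taylorCoeff 1 d = 0 := taylorCoeff_of_even hd_even (by decide)
  have d0 : taylorCoeff 0 d = 1 := by rw [taylorCoeff_zero, hd0]
  have c_eq : ∀ n : ℕ, taylorCoeff n c = (n + 1) * taylorCoeff (n + 1) s := fun n => by
    rw [← taylorCoeff_deriv, funext fun y => (hs.hasDerivAt y).deriv]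
  have e_eq : ∀ n : ℕ, taylorCoeff n e = (n + 1) * taylorCoeff (n + 1) d := fun n => by
    rw [← taylorCoeff_deriv, funext fun y => (hd.hasDerivAt y).deriv]
  have c0 : taylorCoeff 0 c = σ := by rw [taylorCoeff_zero, hc0]
  have s1 : taylorCoeff 1 s = σ := by simpa [c0] using (c_eq 0).symm
  have e0 : taylorCoeff 0 e = 0 := by simp [e_eq, d1]
  have c1 : taylorCoeff 1 c = 0 := by simp [c_eq, s2]
  have c2 : taylorCoeff 2 c = σ * a₁ / 2 := by
    have h := hs.taylorCoeff_succ_succ 1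
    have h' := c_eq 2
    simp (disch := fun_prop) only [taylorCoeff_mul, Finset.sum_range_succ, Finset.sum_range_zero,
      Nat.reduceAdd, Nat.sub_zero, Nat.sub_self, s0, s1] at h h'
    push_cast at h h'
    linear_combination h' + h / 2
  have d2 : taylorCoeff 2 d = (b₁ - 2 * σ ^ 2) / 2 := by
    have h := hd.taylorCoeff_succ_succ 0
    simp (disch := fun_prop) only [taylorCoeff_mul, Finset.sum_range_succ, Finset.sum_range_zero,
      Nat.reduceAdd, Nat.sub_self, d0] at h
    push_cast at h
    linear_combination h / 2
  have e1 : taylorCoeff 1 e = b₁ - 2 * σ ^ 2 := by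
    have h := e_eq 1
    rw [d2] at h
    push_cast at h
    linear_combination h
  set P : ℝ → ℝ := fun x => angleDeriv₁ (s x) (c x) (d x) with hP
  set Q : ℝ → ℝ := fun x => angleDeriv₂ (s x) (d x) (e x) with hQ
  have kP : ContDiff ℝ ∞ P := by
    simp only [hP, angleDeriv₁]
    exact ContDiff.div (by fun_prop) (by fun_prop) fun x => by positivity
  have kQ : ContDiff ℝ ∞ Q := by
    simp only [hQ, angleDeriv₂]
    exact ContDiff.div (by fun_prop) (by fun_prop) fun x => by positivity
  have hP' : (fun x => c x * d x)
      = fun x => P x + P x * ((s x * d x) * (s x * d x)) := funext fun x => by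
    have : 1 + (s x * d x) ^ 2 ≠ 0 := by positivity
    simp only [hP, angleDeriv₁]
    field_simp
  have hQ' : (fun x => s x * e x)
      = fun x => Q x + Q x * ((s x * d x) * (s x * d x)) := funext fun x => by
    have : 1 + (s x * d x) ^ 2 ≠ 0 := by positivity
    simp only [hQ, angleDeriv₂]
    field_simp
  have P0 := congrArg (taylorCoeff 0) hP'
  have P2 := congrArg (taylorCoeff 2) hP'
  have Q0 := congrArg (taylorCoeff 0) hQ'
  have Q2 := congrArg (taylorCoeff 2) hQ'
  simp (disch := fun_prop) only [taylorCoeff_add, taylorCoeff_mul, Finset.sum_range_succ,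
    Finset.sum_range_zero, Nat.reduceAdd, Nat.reduceSub, Nat.sub_zero, Nat.sub_self, zero_add,
    add_zero, mul_zero, zero_mul, mul_one, s0, s1, s2, d0, d1, d2, c0, c1, c2, e0, e1]
    at P0 P2 Q0 Q2
  rw [← P0] at P2
  rw [← Q0] at Q2
  have hflow : twoPhaseFlow s c d e δ γ 0 0 0 = fun x => 2 * δ * P x + 2 * γ * Q x :=
    funext fun x => by
      simp only [twoPhaseFlow, mul_zero, add_zero, hP, hQ]
      ring
  rw [hflow, taylorCoeff_add (by fun_prop) (by fun_prop), taylorCoeff_const_mul,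
    taylorCoeff_const_mul]
  linear_combination (-2 * δ) * P2 - 2 * γ * Q2

/-- The equation says that `Φ(u) + 2 ∂ₜΘ` does not depend on `x`, so its second Taylor coefficient
vanishes. -/
lemma taylorCoeff_two_add_eq_zero_of_isSmoothSolution {a₀ b₂ : ℝ} {Φ : (ℝ → ℝ) → ℝ → ℝ}
    (hs : QuarticOscillator s c a₀ a₁ a₂) (hd : QuarticOscillator d e b₀ b₁ b₂) {δ γ : ℝ}
    (hΦ : ∀ u : ℝ → ℝ, ContDiff ℝ ∞ u → ContDiff ℝ ∞ (Φ u))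
    (h : IsSmoothSolution Φ (twoPhase s c d e δ γ 0 0)) :
    taylorCoeff 2 (Φ (twoPhase s c d e δ γ 0 0 0))
      + taylorCoeff 2 (twoPhaseFlow s c d e δ γ 0 0 0) = 0 := by
  have hu := contDiff_twoPhase_apply hs hd δ γ 0 0 0
  have h1 := hΦ _ hu
  have h2 := contDiff_twoPhaseFlow hs hd δ γ 0 0 0
  rw [← taylorCoeff_add h1 h2]
  have h3 := taylorCoeff_deriv (fun x => Φ (twoPhase s c d e δ γ 0 0 0) x
    + twoPhaseFlow s c d e δ γ 0 0 0 x) 1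
  have h4 : deriv (fun x => Φ (twoPhase s c d e δ γ 0 0 0) x
      + twoPhaseFlow s c d e δ γ 0 0 0 x) = fun _ => 0 := funext fun x => by
    rw [deriv_fun_add (h1.differentiable (by simp) x) (h2.differentiable (by simp) x), add_comm,
      ← deriv_twoPhase_time hs hd]
    exact h.2 0 x
  rw [h4, taylorCoeff, iteratedDeriv_fun_const_zero] at h3
  push_cast at h3
  linarith

end Jets

/-! ### The necessity of resonance -/

section Necessity

variable {α β k m b₀ : ℝ} {s c d e : ℝ → ℝ}

lemma twoPhase_zero_eq (s c d e : ℝ → ℝ) (δ γ x : ℝ) : twoPhase s c d e δ γ 0 0 0 x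
    = 2 * (angleDeriv₁ (s x) (c x) (d x) + angleDeriv₂ (s x) (d x) (e x)) := by
  simp [twoPhase]

/-- In both orders the second Taylor coefficient of `Φ(u) + 2 ∂ₜΘ` at the origin is the resonance
defect `k α⁴ - β⁴ (1 - m)` times a factor that never vanishes. -/
lemma resonance_of_isSmoothSolution_twoPhase (hα : 0 < α) (hβ : 0 < β) (hk : 0 ≤ k) (hm : 0 ≤ m)
    (hs : QuarticOscillator s c (β ^ 2) (-α ^ 2 * (1 + k)) (k * α ^ 4 / β ^ 2))
    (hd : QuarticOscillator d e b₀ (β ^ 2 * (2 - m)) (-β ^ 2))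
    (hs_odd : ∀ y, s (-y) = -s y) (hc_even : ∀ y, c (-y) = c y) (hd_even : ∀ y, d (-y) = d y)
    (he_odd : ∀ y, e (-y) = -e y) (hc0 : c 0 = β) (hd0 : d 0 = 1)
    (h : SolvesMKdV5 (twoPhase s c d e (delta5 α β k m) (gamma5 α β k m) 0 0) ∨
      SolvesMKdV7 (twoPhase s c d e (delta7 α β k m) (gamma7 α β k m) 0 0)) :
    k * α ^ 4 / β ^ 2 = β ^ 2 * (1 - m) := by
  have hu_even : ∀ δ γ x, twoPhase s c d e δ γ 0 0 0 (-x) = twoPhase s c d e δ γ 0 0 0 x :=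
    fun δ γ x => by
      rw [twoPhase_zero_eq, twoPhase_zero_eq, hs_odd, hc_even, hd_even, he_odd]
      simp [angleDeriv₁, angleDeriv₂]
  have hu : ∀ δ γ, ContDiff ℝ ∞ (twoPhase s c d e δ γ 0 0 0) := fun δ γ =>
    contDiff_twoPhase_apply hs hd δ γ 0 0 0
  have hβ' := hβ.ne'
  have jets := fun δ γ => taylorCoeff_twoPhase hs hd hs_odd hd_even hc0 hd0
    (twoPhase_zero_eq s c d e δ γ) (hu δ γ)
  have flow := taylorCoeff_two_twoPhaseFlow hs hd hs_odd hd_even hc0 hd0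
  rw [div_eq_iff (by positivity), ← sub_eq_zero]
  rcases h with h | h
  · have key := taylorCoeff_two_add_eq_zero_of_isSmoothSolution hs hd
      (fun u hu => contDiff_flux5 hu) h
    obtain ⟨u0, u2, u4, u6, -⟩ := jets (delta5 α β k m) (gamma5 α β k m)
    rw [taylorCoeff_two_flux5 (hu _ _) (hu_even _ _), flow, u0, u2, u4, u6, delta5, gamma5] at key
    have factor : β * (160 * β ^ 2 * m + 80 * β ^ 2 + 160 * α ^ 2 * (1 + k))
        * (k * α ^ 4 - β ^ 2 * (1 - m) * β ^ 2) = 0 := by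
      rw [← neg_eq_zero, ← key]
      field_simp
      ring
    exact (mul_eq_zero.1 factor).resolve_left (by positivity)
  · have key := taylorCoeff_two_add_eq_zero_of_isSmoothSolution hs hd
      (fun u hu => contDiff_flux7 hu) h
    obtain ⟨u0, u2, u4, u6, u8⟩ := jets (delta7 α β k m) (gamma7 α β k m)
    rw [taylorCoeff_two_flux7 (hu _ _) (hu_even _ _), flow, u0, u2, u4, u6, u8, delta7,
      gamma7] at key
    have factor : β * (β ^ 4 * (420 * m ^ 2 + 6384 * m + 3360)
          + α ^ 2 * β ^ 2 * ((1 + k) * (2520 * m + 3360))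
          + α ^ 4 * (1092 * k ^ 2 + 5208 * k + 1092))
        * (k * α ^ 4 - β ^ 2 * (1 - m) * β ^ 2) = 0 := by
      rw [← key]
      field_simp
      ring
    exact (mul_eq_zero.1 factor).resolve_left (by positivity)

lemma resonance_of_solves (hα : 0 < α) (hβ : 0 < β) (hk : k ∈ Set.Ico (0 : ℝ) 1)
    (hm : m ∈ Set.Ico (0 : ℝ) 1)
    (h : SolvesMKdV5 (breather α β k m (delta5 α β k m) (gamma5 α β k m) 0 0) ∨
      SolvesMKdV7 (breather α β k m (delta7 α β k m) (gamma7 α β k m) 0 0)) :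
    β ^ 4 / α ^ 4 = k / (1 - m) := by
  rw [breather_eq_twoPhase hα hβ hk hm, breather_eq_twoPhase hα hβ hk hm] at h
  rw [resonance_iff hα hβ hm.2]
  refine resonance_of_isSmoothSolution_twoPhase hα hβ hk.1 hm.1
    (quarticOscillator_sn hα hβ hk) (quarticOscillator_dn β hm)
    (fun y => ?_) (fun y => ?_) (fun y => ?_) (fun y => ?_) ?_ ?_ h
  · rw [mul_neg, jacobiSn_neg hk, mul_neg]
  · rw [mul_neg, jacobiAm_neg hk, Real.cos_neg, jacobiDn_neg hk]
  · rw [mul_neg, jacobiDn_neg hm]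
  · rw [mul_neg, jacobiAm_neg hm, Real.cos_neg, jacobiSn_neg hm]
    ring
  · rw [mul_zero, jacobiAm_zero hk, jacobiDn_zero hk, Real.cos_zero, mul_one, mul_one]
  · rw [mul_zero, jacobiDn_zero hm]

end Necessity

/-! ### Spatial periods -/

/-- A bounded antiderivative of a periodic function is periodic. -/
lemma periodic_of_periodic_deriv {f : ℝ → ℝ} {C T : ℝ} (hf : Differentiable ℝ f)
    (hC : ∀ x, |f x| ≤ C) (hT : Function.Periodic (deriv f) T) : Function.Periodic f T := by
  have hder : ∀ x, HasDerivAt (fun x => f (x + T) - f x) 0 x := fun x =>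
    (((hf (x + T)).hasDerivAt.comp_add_const x T).sub (hf x).hasDerivAt).congr_deriv (by
      rw [hT x, sub_self])
  have hconst : ∀ x, f (x + T) - f x = f (0 + T) - f 0 := fun x =>
    is_const_of_deriv_eq_zero (fun y => (hder y).differentiableAt) (fun y => (hder y).deriv) x 0
  set c := f (0 + T) - f 0 with hc
  have hn : ∀ n : ℕ, f (n * T) = f 0 + n * c := fun n => by
    induction n with
    | zero => simp
    | succ n ih =>
      have h := hconst (n * T)
      rw [ih] at h
      push_cast
      rw [add_mul, one_mul]
      linarith
  have hc0 : c = 0 := by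
    by_contra hne
    obtain ⟨n, hlt⟩ := exists_nat_gt (2 * C / |c|)
    rw [div_lt_iff₀ (abs_pos.2 hne)] at hlt
    have h1 : |(n : ℝ) * c| ≤ 2 * C := by
      rw [show (n : ℝ) * c = f (n * T) - f 0 by rw [hn]; ring]
      exact (abs_sub _ _).trans (by linarith [hC (n * T), hC 0])
    rw [abs_mul, Nat.abs_cast] at h1
    linarith
  intro x
  have h := hconst x
  linarith

section Period

variable {α β k m : ℝ}

/-- Under the commensurability condition `4 K(k) / α` is a period of both factors of
`sn(α y₁, k) dn(β y₂, m)`. A smaller one would carry zeros of the product to zeros, hence be half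
of it, and that shift changes the sign of the product. -/
lemma hasSpatialPeriod_breather (hα : 0 < α) (hβ : 0 < β) (hk : k ∈ Set.Ico (0 : ℝ) 1)
    (hm : m ∈ Set.Ico (0 : ℝ) 1) (h : 4 / α * ellipticK k = 2 / β * ellipticK m)
    (δ γ x₁ x₂ : ℝ) :
    HasSpatialPeriod (breather α β k m δ γ x₁ x₂) (4 / α * ellipticK k) := by
  intro t
  have hKk := ellipticK_pos hk
  set p := δ * t + x₁ with hp
  set q := γ * t + x₂ with hq
  set f : ℝ → ℝ := fun z => β / α * jacobiSn (α * (z + p)) k * jacobiDn (β * (z + q)) m with hf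
  have hbr : ∀ x, breather α β k m δ γ x₁ x₂ t x = 2 * deriv (fun z => Real.arctan (f z)) x :=
    fun x => by
      rw [breather]
      congr 2
      funext z
      rw [jacobiNd, div_div_eq_mul_div, div_one, hf]
      simp only [hp, hq, ← add_assoc, mul_assoc]
  have hdiff : Differentiable ℝ fun z => Real.arctan (f z) := by
    have h1 := (contDiff_jacobiSn hk).differentiable (by simp)
    have h2 := (contDiff_jacobiDn hm).differentiable (by simp)
    refine Differentiable.arctan ?_
    simp only [hf]
    fun_prop
  -- half a period flips the sign of the `sn` factor
  have hsn : ∀ z, jacobiSn (α * (z + 2 / α * ellipticK k + p)) k = -jacobiSn (α * (z + p)) k :=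
    fun z => by
      rw [← jacobiSn_add_two_mul_ellipticK hk]
      congr 1
      field_simp
      ring
  refine ⟨⟨by positivity, fun x => ?_⟩, ?_⟩
  · have hper : Function.Periodic (fun z => Real.arctan (f z)) (4 / α * ellipticK k) := fun z => by
      have h1 : jacobiSn (α * (z + 4 / α * ellipticK k + p)) k = jacobiSn (α * (z + p)) k := by
        rw [show z + 4 / α * ellipticK k
          = z + 2 / α * ellipticK k + 2 / α * ellipticK k by ring, hsn, hsn, neg_neg]
      have h2 : jacobiDn (β * (z + 4 / α * ellipticK k + q)) m = jacobiDn (β * (z + q)) m := by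
        rw [h, ← jacobiDn_add_two_mul_ellipticK hm (β * (z + q))]
        congr 1
        field_simp
        ring
      simp only [hf, h1, h2]
    rw [hbr, hbr, ← deriv_comp_add_const, funext hper]
  · rintro T ⟨hT0, hT⟩
    -- a period of the derivative is a period of the angle, as the latter is bounded
    have hper : Function.Periodic (fun z => Real.arctan (f z)) T := by
      refine periodic_of_periodic_deriv (C := Real.pi / 2) hdiff (fun x => ?_) fun x => ?_
      · exact abs_le.2 ⟨(Real.neg_pi_div_two_lt_arctan _).le, (Real.arctan_lt_pi_div_two _).le⟩
      · have := hT x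
        rw [hbr, hbr] at this
        linarith
    have hfT : ∀ z, f (z + T) = f z := fun z => Real.arctan_injective (hper z)
    -- the zeros of `f` are those of the `sn` factor
    have hzero : jacobiSn (α * T) k = 0 := by
      have h1 := hfT (-p)
      have h2 : jacobiSn (α * (-p + p)) k = 0 := by
        rw [neg_add_cancel, mul_zero, jacobiSn_zero hk]
      simp only [hf, h2, mul_zero, zero_mul] at h1
      rw [show -p + T + p = T by ring] at h1
      simpa [hα.ne', hβ.ne', (jacobiDn_pos hm _).ne'] using h1
    obtain ⟨n, hn⟩ := (jacobiSn_eq_zero_iff hk _).1 hzero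
    have hTn : T = n * (2 / α * ellipticK k) := by
      field_simp
      linear_combination hn
    have hn0 : 0 < n := by
      have : (0 : ℝ) < n := by
        by_contra hle
        have : (n : ℝ) * (2 / α * ellipticK k) ≤ 0 :=
          mul_nonpos_of_nonpos_of_nonneg (not_lt.1 hle) (by positivity)
        linarith
      exact_mod_cast this
    have hn1 : n ≠ 1 := by
      rintro rfl
      rw [Int.cast_one, one_mul] at hTn
      -- compare the signs of `f` at the quarter period, where `sn = 1`, and half a period later
      have hz : jacobiSn (α * (ellipticK k / α - p + p)) k = 1 := by
        rw [show α * (ellipticK k / α - p + p) = ellipticK k by field_simp; ring, jacobiSn,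
          ← ellipticF_pi_div_two, jacobiAm_ellipticF hk, Real.sin_pi_div_two]
      have h1 := hfT (ellipticK k / α - p)
      simp only [hf] at h1
      rw [hTn, hsn, hz] at h1
      have h2 := mul_pos (div_pos hβ hα)
        (jacobiDn_pos hm (β * (ellipticK k / α - p + 2 / α * ellipticK k + q)))
      have h3 := mul_pos (div_pos hβ hα) (jacobiDn_pos hm (β * (ellipticK k / α - p + q)))
      linarith
    have hn2 : (2 : ℝ) ≤ n := by
      have : 2 ≤ n := by omega
      exact_mod_cast this
    rw [hTn]
    calc 4 / α * ellipticK k = 2 * (2 / α * ellipticK k) := by ring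
      _ ≤ n * (2 / α * ellipticK k) := by gcongr

lemma hasSpatialPeriod_breather_iff (hα : 0 < α) (hβ : 0 < β) (hk : k ∈ Set.Ico (0 : ℝ) 1)
    (hm : m ∈ Set.Ico (0 : ℝ) 1) (δ γ x₁ x₂ : ℝ) :
    (HasSpatialPeriod (breather α β k m δ γ x₁ x₂) (4 / α * ellipticK k) ∧
      HasSpatialPeriod (breather α β k m δ γ x₁ x₂) (2 / β * ellipticK m)) ↔
    ellipticK k = α / (2 * β) * ellipticK m := by
  have hiff : ellipticK k = α / (2 * β) * ellipticK m ↔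
      4 / α * ellipticK k = 2 / β * ellipticK m := by
    field_simp
    constructor <;> intro h <;> linarith
  rw [hiff]
  constructor
  · rintro ⟨h1, h2⟩
    exact (h1 0).unique (h2 0)
  · intro h
    have h1 := hasSpatialPeriod_breather hα hβ hk hm h δ γ x₁ x₂
    exact ⟨h1, h ▸ h1⟩

end Period

end PeriodicMKdV

theorem theorem1p6 (α β k m : ℝ) (hα : 0 < α) (hβ : 0 < β)
    (hk : k ∈ Set.Ico (0 : ℝ) 1) (hm : m ∈ Set.Ico (0 : ℝ) 1) :
    -- 5th order equation
    (((∀ x₁ x₂ : ℝ,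
          PeriodicMKdV.SolvesMKdV5 (PeriodicMKdV.breather α β k m
            (PeriodicMKdV.delta5 α β k m) (PeriodicMKdV.gamma5 α β k m) x₁ x₂)) ↔
        β ^ 4 / α ^ 4 = k / (1 - m)) ∧
      ∀ x₁ x₂ : ℝ,
        (PeriodicMKdV.HasSpatialPeriod (PeriodicMKdV.breather α β k m
            (PeriodicMKdV.delta5 α β k m) (PeriodicMKdV.gamma5 α β k m) x₁ x₂)
            (4 / α * PeriodicMKdV.ellipticK k) ∧
          PeriodicMKdV.HasSpatialPeriod (PeriodicMKdV.breather α β k m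
            (PeriodicMKdV.delta5 α β k m) (PeriodicMKdV.gamma5 α β k m) x₁ x₂)
            (2 / β * PeriodicMKdV.ellipticK m)) ↔
        PeriodicMKdV.ellipticK k = α / (2 * β) * PeriodicMKdV.ellipticK m) ∧
    -- 7th order equation
    (((∀ x₁ x₂ : ℝ,
          PeriodicMKdV.SolvesMKdV7 (PeriodicMKdV.breather α β k m
            (PeriodicMKdV.delta7 α β k m) (PeriodicMKdV.gamma7 α β k m) x₁ x₂)) ↔
        β ^ 4 / α ^ 4 = k / (1 - m)) ∧
      ∀ x₁ x₂ : ℝ,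
        (PeriodicMKdV.HasSpatialPeriod (PeriodicMKdV.breather α β k m
            (PeriodicMKdV.delta7 α β k m) (PeriodicMKdV.gamma7 α β k m) x₁ x₂)
            (4 / α * PeriodicMKdV.ellipticK k) ∧
          PeriodicMKdV.HasSpatialPeriod (PeriodicMKdV.breather α β k m
            (PeriodicMKdV.delta7 α β k m) (PeriodicMKdV.gamma7 α β k m) x₁ x₂)
            (2 / β * PeriodicMKdV.ellipticK m)) ↔
        PeriodicMKdV.ellipticK k = α / (2 * β) * PeriodicMKdV.ellipticK m) := by
  refine ⟨⟨⟨fun h => ?_, fun h x₁ x₂ => ?_⟩, fun x₁ x₂ => ?_⟩,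
    ⟨⟨fun h => ?_, fun h x₁ x₂ => ?_⟩, fun x₁ x₂ => ?_⟩⟩
  · exact PeriodicMKdV.resonance_of_solves hα hβ hk hm (Or.inl (h 0 0))
  · exact (PeriodicMKdV.solves_of_resonance hα hβ hk hm h x₁ x₂).1
  · exact PeriodicMKdV.hasSpatialPeriod_breather_iff hα hβ hk hm _ _ x₁ x₂
  · exact PeriodicMKdV.resonance_of_solves hα hβ hk hm (Or.inr (h 0 0))
  · exact (PeriodicMKdV.solves_of_resonance hα hβ hk hm h x₁ x₂).2
  · exact PeriodicMKdV.hasSpatialPeriod_breather_iff hα hβ hk hm _ _ x₁ x₂
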